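/- A $3$-graph is a pair $H=(V,E)$ with $V$ a finite set and $E$ a family of $3$-element subsets of $V$. Let $P_3^3$ be the $3$-uniform linear path of length $3$, i.e. the $3$-graph on $7$ vertices $v_1,\dots,v_7$ with the three edges $\{v_1,v_2,v_3\},\{v_3,v_4,v_5\},\{v_5,v_6,v_7\}$. A $3$-graph is $P_3^3$-free if it has no (not necessarily induced) subhypergraph isomorphic to $P_3^3$. Let $ex_3(n;P_3^3)$ be the maximum number of edges in a $P_3^3$-free $3$-graph on $n$ vertices, and let $Ex_3(n;P_3^3)$ be the set of all $P_3^3$-free $3$-graphs on $n$ vertices with exactly $ex_3(n;P_3^3)$ edges, taken up to isomorphism. Let $K_n^3$ be the complete $3$-graph on $n$ vertices (all $\binom n3$ triples; no edges if $n<3$), let $S_n^3$ be the full star on $n$ vertices (all $\binom{n-1}2$ triples that contain one fixed vertex), and let $F\cup H$ be the union of vertex-disjoint copies of $F$ and $H$. Then for every integer $n\ge 0$: - if $n\le 6$, then $ex_3(n;P_3^3)=\binom n3$ and $Ex_3(n;P_3^3)=\{K_n^3\}$; - if $n=7$, then $ex_3(n;P_3^3)=20$ and $Ex_3(n;P_3^3)=\{K_6^3\cup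 K_1^3\}$; - if $n\ge 8$, then $ex_3(n;P_3^3)=\binom{n-1}{2}$ and $Ex_3(n;P_3^3)=\{S_n^3\}$. -/

import Mathlib

universe u

/-- A `k`-uniform hypergraph (`k`-graph) with vertex set `V`: a family of `k`-element subsets
of `V`, the edges. -/
structure KGraph (k : ℕ) (V : Type*) where
  /-- the edges -/
  edges : Finset (Finset V)
  /-- every edge has exactly `k` elements -/
  card_of_mem : ∀ e ∈ edges, e.card = k

namespace KGraph

/-- The number of edges `|H|`. -/
def size {k : ℕ} {V : Type*} (H : KGraph k V) : ℕ := H.edges.card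

/-- `H.Contains F`: some subhypergraph of `H` is a copy of `F` (not necessarily induced). -/
def Contains {k : ℕ} {V W : Type*} (H : KGraph k V) (F : KGraph k W) : Prop :=
  ∃ f : W ↪ V, ∀ e ∈ F.edges, e.map f ∈ H.edges

/-- `H.Free F`: the `k`-graph `H` is `F`-free. -/
def Free {k : ℕ} {V W : Type*} (H : KGraph k V) (F : KGraph k W) : Prop :=
  ¬ H.Contains F

/-- `H.IsIsoTo G`: the `k`-graphs `H` and `G` are isomorphic. -/
def IsIsoTo {k : ℕ} {V W : Type*} (H : KGraph k V) (G : KGraph k W) : Prop :=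
  ∃ σ : V ≃ W, ∀ e : Finset V, e ∈ H.edges ↔ e.map σ.toEmbedding ∈ G.edges

/-- The Turán number `ex_k(n; F)`: the maximum number of edges in an `F`-free `k`-graph
on `n` vertices. -/
noncomputable def turanNumber {k : ℕ} {W : Type*} (n : ℕ) (F : KGraph k W) : ℕ :=
  sSup {m : ℕ | ∃ H : KGraph k (Fin n), H.Free F ∧ H.size = m}

/-- `H` is extremal with respect to `F`: it is `F`-free and has `ex_k(|V|; F)` edges. -/
def IsExtremal {k : ℕ} {V W : Type*} [Fintype V] (H : KGraph k V) (F : KGraph k W) : Prop :=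
  H.Free F ∧ H.size = turanNumber (Fintype.card V) F

/-- `Ex_k(n; F) = {G}`: up to isomorphism, `G` is the one and only `n`-vertex `k`-graph that is
extremal with respect to `F`. -/
def UniqueExtremal {k : ℕ} {W U : Type*} (n : ℕ) (F : KGraph k W) (G : KGraph k U) : Prop :=
  ∀ (V : Type u) [Fintype V], Fintype.card V = n →
    ∀ H : KGraph k V, H.IsExtremal F ↔ H.IsIsoTo G

/-- The complete `k`-graph `K_n^k` on the vertex set `Fin n`. -/
def complete (k n : ℕ) : KGraph k (Fin n) where
  edges := Finset.univ.powersetCard k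
  card_of_mem := fun _ he => (Finset.mem_powersetCard.mp he).2

/-- The full star `S_n^k` on the vertex set `Fin n` with centre `v`: its edges are all the
`k`-element sets of vertices that contain `v`. -/
def fullStar (k : ℕ) {n : ℕ} (v : Fin n) : KGraph k (Fin n) where
  edges := (Finset.univ.powersetCard k).filter (fun e => v ∈ e)
  card_of_mem := fun _ he => (Finset.mem_powersetCard.mp (Finset.mem_filter.mp he).1).2

/-- The union `F ∪ H` of vertex-disjoint copies of `F` and `H`. -/
def disjointUnion {k : ℕ} {V W : Type*} [DecidableEq V] [DecidableEq W]
    (F : KGraph k V) (H : KGraph k W) : KGraph k (V ⊕ W) where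
  edges := F.edges.image (fun e => e.map Function.Embedding.inl) ∪
    H.edges.image (fun e => e.map Function.Embedding.inr)
  card_of_mem := by
    intro e he
    rcases Finset.mem_union.mp he with h | h
    · obtain ⟨a, ha, rfl⟩ := Finset.mem_image.mp h
      rw [Finset.card_map]
      exact F.card_of_mem a ha
    · obtain ⟨a, ha, rfl⟩ := Finset.mem_image.mp h
      rw [Finset.card_map]
      exact H.card_of_mem a ha

/-- The 3-uniform linear path `P_3^3` of length 3: seven vertices and three edges, consecutive
edges sharing exactly one vertex and the first and the last edge being disjoint. -/
def linearPath33 : KGraph 3 (Fin 7) where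
  edges := {{0, 1, 2}, {2, 3, 4}, {4, 5, 6}}
  card_of_mem := by
    intro e he
    simp only [Finset.mem_insert, Finset.mem_singleton] at he
    rcases he with rfl | rfl | rfl <;> rfl

end KGraph

namespace KGraph

/-! A linear path is present exactly when some edge meets two disjoint edges without lying in their
union, so the problem concerns families of triples satisfying `PathFree`. Intersecting families and
families on six points satisfy it trivially, which explains the two kinds of extremal graph.

For `n ≥ 8` the core is a degree bound: some vertex has degree at most `n - 2`
(`PathFree.exists_card_edgesAt_lt`). As C(n-1,2) = C(n-2,2) + (n-2), deleting that vertex passes the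
strict bound for non-stars from `n - 1` to `n`; `PathFree.card_lt_of_erase` also treats the case
where a star remains. The induction cannot start at seven points, where K_6 with its 20 edges beats
the star with 15. At `n = 8` two disjoint edges force at most 20 < 21 edges
(`PathFree.card_le_twenty`), and an intersecting family reduces to the bound 15 on seven points
(`Intersecting.card_le_fifteen`). The same two bounds settle `n = 7`.

For the degree bound, if meeting is transitive on edges, the family splits into intersecting
components, where `Intersecting.exists_card_edgesAt_lt` or a trivial count applies. Otherwise an
edge meets two disjoint edges `e`, `f`. Applying `PathFree.trichotomy` to `(e, f)` and `(f, e)`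
leaves, up to symmetry, six combinations; five yield a vertex of low degree and the sixth excludes
the connecting edge. -/

/-- A combinatorial form of not containing the linear path of length three: an edge that meets
two disjoint edges lies in their union. -/
def PathFree {V : Type*} [DecidableEq V] (F : Finset (Finset V)) : Prop :=
  ∀ e ∈ F, ∀ f ∈ F, ∀ g ∈ F, Disjoint e f → ¬ Disjoint g e → ¬ Disjoint g f → g ⊆ e ∪ f

/-- The edges of `F` through `v`. -/
def edgesAt {V : Type*} [DecidableEq V] (F : Finset (Finset V)) (v : V) : Finset (Finset V) :=
  F.filter (fun g => v ∈ g)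

/-! ### Counting triples, and the structure around two disjoint edges -/

section Triples

variable {V : Type*} [DecidableEq V]

lemma mem_edgesAt {F : Finset (Finset V)} {v : V} {g : Finset V} :
    g ∈ edgesAt F v ↔ g ∈ F ∧ v ∈ g := Finset.mem_filter

/-- Removing `A` maps `G` injectively to the `(3 - |A|)`-subsets of `B \ A`. If `A ⊆ B` fails, `G`
is empty. The cases `|A| = 2, 1, 0` below carry most of the counting. -/
lemma card_le_of_between {G : Finset (Finset V)} {A B : Finset V}
    (h : ∀ g ∈ G, g.card = 3 ∧ A ⊆ g ∧ g ⊆ B) :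
    G.card ≤ (B.card - A.card).choose (3 - A.card) := by
  by_cases hAB : A ⊆ B
  · rw [← Finset.card_sdiff_of_subset hAB, ← Finset.card_powersetCard]
    refine Finset.card_le_card_of_injOn (fun g => g \ A) ?_ ?_
    · intro g hg
      obtain ⟨h3, h1, h2⟩ := h g hg
      refine Finset.mem_coe.2 (Finset.mem_powersetCard.2 ?_)
      exact ⟨Finset.sdiff_subset_sdiff h2 le_rfl, by rw [Finset.card_sdiff_of_subset h1, h3]⟩
    · intro g hg g' hg' hh
      obtain ⟨-, h1, -⟩ := h g hg
      obtain ⟨-, h1', -⟩ := h g' hg'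
      have : g \ A = g' \ A := hh
      rw [← Finset.sdiff_union_of_subset h1, ← Finset.sdiff_union_of_subset h1', this]
  · rcases G.eq_empty_or_nonempty with rfl | ⟨g, hg⟩
    · simp
    · exact absurd ((h g hg).2.1.trans (h g hg).2.2) hAB

lemma card_le_of_pair {G : Finset (Finset V)} {a b : V} {B : Finset V} (hab : a ≠ b)
    (h : ∀ g ∈ G, g.card = 3 ∧ a ∈ g ∧ b ∈ g ∧ g ⊆ B) : G.card ≤ B.card - 2 := by
  have := card_le_of_between (G := G) (A := {a, b}) (B := B) (fun g hg => by
    obtain ⟨h1, h2, h3, h4⟩ := h g hg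
    exact ⟨h1, by simp [Finset.insert_subset_iff, h2, h3], h4⟩)
  rwa [Finset.card_pair hab, Nat.choose_one_right] at this

lemma card_le_of_point {G : Finset (Finset V)} {a : V} {B : Finset V}
    (h : ∀ g ∈ G, g.card = 3 ∧ a ∈ g ∧ g ⊆ B) : G.card ≤ (B.card - 1).choose 2 := by
  have := card_le_of_between (G := G) (A := {a}) (B := B) (fun g hg => by
    obtain ⟨h1, h2, h4⟩ := h g hg
    exact ⟨h1, by simp [h2], h4⟩)
  simpa using this

lemma card_le_of_subset {G : Finset (Finset V)} {B : Finset V}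
    (h : ∀ g ∈ G, g.card = 3 ∧ g ⊆ B) : G.card ≤ B.card.choose 3 := by
  have := card_le_of_between (G := G) (A := ∅) (B := B) (fun g hg => by
    obtain ⟨h1, h4⟩ := h g hg
    exact ⟨h1, by simp, h4⟩)
  simpa using this

lemma card_le_add_of_forall_or {G : Finset (Finset V)} (p q : Finset V → Prop)
    [DecidablePred p] [DecidablePred q] (h : ∀ g ∈ G, p g ∨ q g) :
    G.card ≤ (G.filter p).card + (G.filter q).card := by
  refine (Finset.card_le_card ?_).trans (Finset.card_union_le _ _)
  intro g hg
  simpa [hg] using h g hg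

lemma card_le_add_of_forall_or_or {G : Finset (Finset V)} (p q r : Finset V → Prop)
    [DecidablePred p] [DecidablePred q] [DecidablePred r] (h : ∀ g ∈ G, p g ∨ q g ∨ r g) :
    G.card ≤ (G.filter p).card + (G.filter q).card + (G.filter r).card := by
  refine (Finset.card_le_card ?_).trans ((Finset.card_union_le (G.filter p ∪ G.filter q)
    (G.filter r)).trans (Nat.add_le_add_right (Finset.card_union_le _ _) _))
  intro g hg
  simpa [hg, or_assoc] using h g hg

lemma eq_of_mem_of_card_eq_three {g : Finset V} (hg : g.card = 3) {x y z : V} (hx : x ∈ g)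
    (hy : y ∈ g) (hz : z ∈ g) (hxy : x ≠ y) (hxz : x ≠ z) (hyz : y ≠ z) : g = {x, y, z} := by
  symm
  apply Finset.eq_of_subset_of_card_le
  · simp [Finset.insert_subset_iff, hx, hy, hz]
  · rw [hg, Finset.card_eq_three.2 ⟨x, y, z, hxy, hxz, hyz, rfl⟩]

lemma exists_eq_of_mem {g : Finset V} (hg : g.card = 3) {x : V} (hx : x ∈ g) :
    ∃ y z, x ≠ y ∧ x ≠ z ∧ y ≠ z ∧ g = {x, y, z} := by
  have h2 : (g.erase x).card = 2 := by rw [Finset.card_erase_of_mem hx, hg]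
  obtain ⟨y, z, hyz, h⟩ := Finset.card_eq_two.1 h2
  have hy : y ∈ g.erase x := by simp [h]
  have hz : z ∈ g.erase x := by simp [h]
  rw [Finset.mem_erase] at hy hz
  exact ⟨y, z, hy.1.symm, hz.1.symm, hyz,
    eq_of_mem_of_card_eq_three hg hx hy.2 hz.2 hy.1.symm hz.1.symm hyz⟩

lemma exists_eq_of_mem_of_mem {g : Finset V} (hg : g.card = 3) {x y : V} (hx : x ∈ g)
    (hy : y ∈ g) (hxy : x ≠ y) : ∃ z, x ≠ z ∧ y ≠ z ∧ g = {x, y, z} := by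
  obtain ⟨u, v, h1, h2, h3, rfl⟩ := exists_eq_of_mem hg hx
  simp only [Finset.mem_insert, Finset.mem_singleton] at hy
  rcases hy with rfl | rfl | rfl
  · exact absurd rfl hxy
  · exact ⟨v, h2, h3, rfl⟩
  · refine ⟨u, h1, h3.symm, ?_⟩
    rw [Finset.pair_comm]

lemma card_edgesAt_add {F : Finset (Finset V)} (v : V) :
    (edgesAt F v).card + (F.filter (fun g => v ∉ g)).card = F.card :=
  Finset.card_filter_add_card_filter_not _

/-- The three possibilities for the edges that meet the first of two disjoint edges. -/
lemma PathFree.trichotomy {F : Finset (Finset V)} (hP : PathFree F)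
    (h3 : ∀ g ∈ F, g.card = 3) {e f : Finset V} (he : e ∈ F) (hf : f ∈ F) (hd : Disjoint e f) :
    (∀ g ∈ F, ¬ Disjoint g e → g ⊆ e ∪ f) ∨
    (∃ a b c, a ≠ b ∧ a ≠ c ∧ b ≠ c ∧ e = {a, b, c} ∧
      (∀ g ∈ F, Disjoint g f → (a ∈ g ↔ b ∈ g)) ∧
      (∀ g ∈ F, ¬ Disjoint g f → c ∈ g → a ∉ g ∧ b ∉ g)) ∨
    (∀ g ∈ F, ∀ x ∈ e, ∀ y ∈ e, x ∈ g → y ∈ g → x ≠ y → Disjoint g f) := by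
  by_cases hA : ∀ g ∈ F, ¬ Disjoint g e → g ⊆ e ∪ f
  · exact Or.inl hA
  right
  by_cases hC : ∀ g ∈ F, ∀ x ∈ e, ∀ y ∈ e, x ∈ g → y ∈ g → x ≠ y → Disjoint g f
  · exact Or.inr hC
  left
  push Not at hA hC
  obtain ⟨g₀, hg₀, hg₀e, hg₀W⟩ := hA
  obtain ⟨h, hh, a, ha, b, hb, hah, hbh, hab, hhf⟩ := hC
  have hg₀f : Disjoint g₀ f := by
    by_contra hcon
    exact hg₀W (hP e he f hf g₀ hg₀ hd hg₀e hcon)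
  have key : ∀ h' ∈ F, ¬ Disjoint h' f → ∀ x ∈ e, ∀ y ∈ e, x ∈ h' → y ∈ h' →
      ∀ g ∈ F, Disjoint g f → x ∈ g → y ∈ g := by
    intro h' hh' hh'f x hx y hy hxh hyh g hg hgf hxg
    have := hP g hg f hf h' hh' hgf (Finset.not_disjoint_iff.2 ⟨x, hxh, hxg⟩) hh'f hyh
    rcases Finset.mem_union.1 this with h1 | h1
    · exact h1
    · exact absurd h1 (Finset.disjoint_left.1 hd hy)
  obtain ⟨c, hac, hbc, rfl⟩ := exists_eq_of_mem_of_mem (h3 e he) ha hb hab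
  have hc : c ∈ ({a, b, c} : Finset V) := by simp
  refine ⟨a, b, c, hab, hac, hbc, rfl, fun g hg hgf =>
    ⟨key h hh hhf a ha b hb hah hbh g hg hgf, key h hh hhf b hb a ha hbh hah g hg hgf⟩, ?_⟩
  have hnot : ¬ (a ∈ g₀ ∧ b ∈ g₀ ∧ c ∈ g₀) := by
    rintro ⟨h1, h2, h4⟩
    apply hg₀W
    rw [eq_of_mem_of_card_eq_three (h3 _ hg₀) h1 h2 h4 hab hac hbc]
    exact Finset.subset_union_left
  have h1 := key h hh hhf a ha b hb hah hbh g₀ hg₀ hg₀f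
  have h2 := key h hh hhf b hb a ha hbh hah g₀ hg₀ hg₀f
  have h4 : a ∈ g₀ ∨ b ∈ g₀ ∨ c ∈ g₀ := by
    obtain ⟨x, hx, hxe⟩ := Finset.not_disjoint_iff.1 hg₀e
    simp only [Finset.mem_insert, Finset.mem_singleton] at hxe
    rcases hxe with rfl | rfl | rfl <;> simp [hx]
  -- If `g` contained `c` together with `a` or `b`, then `key` would make `g₀` contain all or none
  -- of `a, b, c`; but `g₀` meets `e` and differs from it.
  intro g hg hgf hcg
  constructor
  · intro hag
    have h5 := key g hg hgf a ha c hc hag hcg g₀ hg₀ hg₀f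
    have h6 := key g hg hgf c hc a ha hcg hag g₀ hg₀ hg₀f
    tauto
  · intro hbg
    have h5 := key g hg hgf b hb c hc hbg hcg g₀ hg₀ hg₀f
    have h6 := key g hg hgf c hc b hb hcg hbg g₀ hg₀ hg₀f
    tauto

end Triples

/-! ### Two disjoint edges on at most eight points -/

section TwoDisjointEdges

variable {V : Type*} [DecidableEq V]

lemma exists_pair_of_two_le {g : Finset V} {e : Finset V} (h : 2 ≤ (g ∩ e).card) :
    ∃ x ∈ e, ∃ y ∈ e, x ∈ g ∧ y ∈ g ∧ x ≠ y := by
  obtain ⟨x, hx, y, hy, hxy⟩ := Finset.one_lt_card.1 h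
  rw [Finset.mem_inter] at hx hy
  exact ⟨x, hx.2, y, hy.2, hx.1, hy.1, hxy⟩

lemma pair_of_two_le {g : Finset V} {a b c : V} (h : 2 ≤ (g ∩ {a, b, c}).card) :
    (a ∈ g ∧ b ∈ g) ∨ (a ∈ g ∧ c ∈ g) ∨ (b ∈ g ∧ c ∈ g) := by
  obtain ⟨x, hx, y, hy, hxg, hyg, hxy⟩ := exists_pair_of_two_le h
  simp only [Finset.mem_insert, Finset.mem_singleton] at hx hy
  grind

/-- The edges that have at least two vertices in `e` or are disjoint from `f`. -/
def edgesNear (F : Finset (Finset V)) (e f : Finset V) : Finset (Finset V) :=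
  F.filter (fun g => 2 ≤ (g ∩ e).card ∨ Disjoint g f)

/-- The trichotomy is counted case by case. On seven points only the first case can reach 10; the
second gives at most 5 and the third at most C(4,3) = 4. On eight points the third can reach C(5,3)
= 10 as well. -/
lemma PathFree.card_edgesNear_le {F : Finset (Finset V)} (hP : PathFree F) {S : Finset V}
    (h3 : ∀ g ∈ F, g.card = 3) (hS : ∀ g ∈ F, g ⊆ S) {e f : Finset V} (he : e ∈ F)
    (hf : f ∈ F) (hd : Disjoint e f) (h8 : S.card ≤ 8) :
    (edgesNear F e f).card ≤ 10 ∧ (S.card = 7 → (edgesNear F e f).card = 10 →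
      ∀ g ∈ F, ¬ Disjoint g e → g ⊆ e ∪ f) := by
  have hW : (e ∪ f).card = 6 := by
    rw [Finset.card_union_of_disjoint hd, h3 e he, h3 f hf]
  have hWS : e ∪ f ⊆ S := Finset.union_subset (hS e he) (hS f hf)
  have hS6 : 6 ≤ S.card := hW ▸ Finset.card_le_card hWS
  have hmem : ∀ g ∈ edgesNear F e f, g ∈ F ∧ (2 ≤ (g ∩ e).card ∨ Disjoint g f) :=
    fun g hg => Finset.mem_filter.1 hg
  rcases hP.trichotomy h3 he hf hd with hA | ⟨a, b, c, hab, hac, hbc, rfl, h1, h2⟩ | hC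
  · refine ⟨?_, fun _ _ => hA⟩
    obtain ⟨a, b, c, hab, hac, hbc, rfl⟩ := Finset.card_eq_three.1 (h3 e he)
    have hsub : ∀ g ∈ edgesNear F {a, b, c} f, 2 ≤ (g ∩ {a, b, c}).card ∧ g ⊆ {a, b, c} ∪ f := by
      intro g hg
      obtain ⟨hgF, hg⟩ := hmem g hg
      have h2 : 2 ≤ (g ∩ {a, b, c}).card := by
        rcases hg with hg | hg
        · exact hg
        by_cases hge : Disjoint g {a, b, c}
        · exfalso
          have h5 : Disjoint g ({a, b, c} ∪ f) := Finset.disjoint_union_right.2 ⟨hge, hg⟩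
          have h6 := Finset.card_le_card (Finset.union_subset (hS g hgF) hWS)
          rw [Finset.card_union_of_disjoint h5, h3 g hgF, hW] at h6
          omega
        · have h5 := hA g hgF hge
          have h6 : g ⊆ {a, b, c} := by
            intro x hx
            rcases Finset.mem_union.1 (h5 hx) with h | h
            · exact h
            · exact absurd h (Finset.disjoint_left.1 hg hx)
          rw [Finset.inter_eq_left.2 h6, h3 g hgF]
          norm_num
      refine ⟨h2, hA g hgF ?_⟩
      rw [Finset.disjoint_iff_inter_eq_empty]
      intro h
      simp [h] at h2
    have ha : a ∈ ({a, b, c} : Finset V) ∪ f := by simp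
    have hb : b ∈ ({a, b, c} : Finset V) ∪ f := by simp
    -- Inside the six points of `e ∪ f`, classifying by the pair contained in `e` gives 4 + 3 + 3 =
    -- 10.
    refine (card_le_add_of_forall_or_or (fun g => a ∈ g ∧ b ∈ g) (fun g => a ∈ g ∧ c ∈ g ∧ b ∉ g)
      (fun g => b ∈ g ∧ c ∈ g ∧ a ∉ g) ?_).trans ?_
    · intro g hg
      have := pair_of_two_le (hsub g hg).1
      tauto
    have k1 := card_le_of_pair (G := (edgesNear F {a, b, c} f).filter (fun g => a ∈ g ∧ b ∈ g))
      (B := {a, b, c} ∪ f) hab (by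
        intro g hg
        rw [Finset.mem_filter] at hg
        exact ⟨h3 g (hmem g hg.1).1, hg.2.1, hg.2.2, (hsub g hg.1).2⟩)
    have k2 := card_le_of_pair
      (G := (edgesNear F {a, b, c} f).filter (fun g => a ∈ g ∧ c ∈ g ∧ b ∉ g))
      (B := ({a, b, c} ∪ f).erase b) hac (by
        intro g hg
        rw [Finset.mem_filter] at hg
        exact ⟨h3 g (hmem g hg.1).1, hg.2.1, hg.2.2.1,
          Finset.subset_erase.2 ⟨(hsub g hg.1).2, hg.2.2.2⟩⟩)
    have k3 := card_le_of_pair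
      (G := (edgesNear F {a, b, c} f).filter (fun g => b ∈ g ∧ c ∈ g ∧ a ∉ g))
      (B := ({a, b, c} ∪ f).erase a) hbc (by
        intro g hg
        rw [Finset.mem_filter] at hg
        exact ⟨h3 g (hmem g hg.1).1, hg.2.1, hg.2.2.1,
          Finset.subset_erase.2 ⟨(hsub g hg.1).2, hg.2.2.2⟩⟩)
    rw [Finset.card_erase_of_mem hb] at k2
    rw [Finset.card_erase_of_mem ha] at k3
    omega
  · have hb : b ∉ f := Finset.disjoint_left.1 hd (by simp)
    have ha : a ∉ f := Finset.disjoint_left.1 hd (by simp)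
    have hD : (insert a (insert b f)).card = 5 := by
      rw [Finset.card_insert_of_notMem (by simp [hab, ha]), Finset.card_insert_of_notMem hb,
        h3 f hf]
    have hDS : insert a (insert b f) ⊆ S := by
      refine Finset.insert_subset (hWS (by simp)) (Finset.insert_subset (hWS (by simp)) (hS f hf))
    -- A counted edge contains both `a` and `b`, or avoids them and `f`. At most three points are
    -- left for the second kind, hence at most one edge.
    have hle := card_le_add_of_forall_or (G := edgesNear F {a, b, c} f)
      (fun g => a ∈ g ∧ b ∈ g) (fun g => g ⊆ S \ insert a (insert b f)) (by
      intro g hg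
      obtain ⟨hgF, hg⟩ := hmem g hg
      by_cases hgf : Disjoint g f
      · by_cases hag : a ∈ g
        · exact Or.inl ⟨hag, (h1 g hgF hgf).1 hag⟩
        · right
          have hbg : b ∉ g := fun h => hag ((h1 g hgF hgf).2 h)
          refine Finset.subset_sdiff.2 ⟨hS g hgF, ?_⟩
          simp [hag, hbg, hgf]
      · left
        have := pair_of_two_le (hg.resolve_right hgf)
        have := h2 g hgF hgf
        tauto)
    have k1 := card_le_of_pair (G := (edgesNear F {a, b, c} f).filter (fun g => a ∈ g ∧ b ∈ g))
      (B := S) hab (by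
        intro g hg
        rw [Finset.mem_filter] at hg
        exact ⟨h3 g (hmem g hg.1).1, hg.2.1, hg.2.2, hS g (hmem g hg.1).1⟩)
    have k2 := card_le_of_subset
      (G := (edgesNear F {a, b, c} f).filter (fun g => g ⊆ S \ insert a (insert b f)))
      (B := S \ insert a (insert b f)) (by
        intro g hg
        rw [Finset.mem_filter] at hg
        exact ⟨h3 g (hmem g hg.1).1, hg.2⟩)
    rw [Finset.card_sdiff_of_subset hDS, hD] at k2
    obtain h | h | h : S.card = 6 ∨ S.card = 7 ∨ S.card = 8 := by omega
    all_goals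
      rw [h] at k1 k2
      simp only [show (6 - 5).choose 3 = 0 from rfl, show (7 - 5).choose 3 = 0 from rfl,
        show (8 - 5).choose 3 = 1 from rfl] at k2
      exact ⟨by omega, fun _ _ => by omega⟩
  · have k2 := card_le_of_subset (G := edgesNear F e f) (B := S \ f) (by
        intro g hg
        obtain ⟨hgF, hg⟩ := hmem g hg
        refine ⟨h3 g hgF, Finset.subset_sdiff.2 ⟨hS g hgF, ?_⟩⟩
        rcases hg with hg | hg
        · obtain ⟨x, hx, y, hy, hxg, hyg, hxy⟩ := exists_pair_of_two_le hg
          exact hC g hgF x hx y hy hxg hyg hxy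
        · exact hg)
    rw [Finset.card_sdiff_of_subset (hS f hf), h3 f hf] at k2
    obtain h | h | h : S.card = 6 ∨ S.card = 7 ∨ S.card = 8 := by omega
    all_goals
      rw [h] at k2
      simp [Nat.choose] at k2
      exact ⟨by omega, fun _ _ => by omega⟩

/-- An edge meeting both `e` and `f` lies in `e ∪ f`, so it has two vertices in one of them. Thus
every edge is near one of the two, and the bound 10 applies twice. -/
lemma PathFree.card_le_twenty {F : Finset (Finset V)} (hP : PathFree F) {S : Finset V}
    (h3 : ∀ g ∈ F, g.card = 3) (hS : ∀ g ∈ F, g ⊆ S) {e f : Finset V} (he : e ∈ F)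
    (hf : f ∈ F) (hd : Disjoint e f) (h8 : S.card ≤ 8) :
    F.card ≤ 20 ∧ (S.card = 7 → F.card = 20 → ∀ g ∈ F, g ⊆ e ∪ f) := by
  have hW : (e ∪ f).card = 6 := by
    rw [Finset.card_union_of_disjoint hd, h3 e he, h3 f hf]
  have hmeet : ∀ g ∈ F, ¬ Disjoint g e ∨ ¬ Disjoint g f := by
    intro g hg
    by_contra! hcon
    have h6 := Finset.card_le_card
      (Finset.union_subset (hS g hg) (Finset.union_subset (hS e he) (hS f hf)))
    rw [Finset.card_union_of_disjoint (Finset.disjoint_union_right.2 hcon), h3 g hg, hW] at h6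
    omega
  have hcov : F ⊆ edgesNear F e f ∪ edgesNear F f e := by
    intro g hg
    simp only [edgesNear, Finset.mem_union, Finset.mem_filter, hg, true_and]
    by_contra! hcon
    obtain ⟨⟨h1, h2⟩, h4, h5⟩ := hcon
    have h6 := hP e he f hf g hg hd h5 h2
    have h7 : g = (g ∩ e) ∪ (g ∩ f) := by
      rw [← Finset.inter_union_distrib_left, Finset.inter_eq_left.2 h6]
    have h8 := Finset.card_union_le (g ∩ e) (g ∩ f)
    rw [← h7, h3 g hg] at h8
    omega
  have hle := (Finset.card_le_card hcov).trans (Finset.card_union_le _ _)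
  obtain ⟨k1, k2⟩ := hP.card_edgesNear_le h3 hS he hf hd h8
  obtain ⟨k3, k4⟩ := hP.card_edgesNear_le h3 hS hf he hd.symm h8
  refine ⟨by omega, fun h7 h20 g hg => ?_⟩
  rcases hmeet g hg with h | h
  · exact k2 h7 (by omega) g hg h
  · rw [Finset.union_comm]
    exact k4 h7 (by omega) g hg h

end TwoDisjointEdges

/-- Any two edges of `F` meet. -/
def Intersecting {V : Type*} (F : Finset (Finset V)) : Prop := ∀ e ∈ F, ∀ f ∈ F, ¬ Disjoint e f

/-! ### Vertices of low degree in intersecting families -/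

section Intersecting

variable {V : Type*} [DecidableEq V]

lemma Intersecting.pathFree {F : Finset (Finset V)} (hI : Intersecting F) : PathFree F :=
  fun e he f hf _ _ hd => absurd hd (hI e he f hf)

lemma not_disjoint_triple {g : Finset V} {a b c : V} :
    ¬ Disjoint g {a, b, c} ↔ a ∈ g ∨ b ∈ g ∨ c ∈ g := by
  simp only [Finset.disjoint_insert_right, Finset.disjoint_singleton_right]
  tauto

lemma exists_mem_notMem_of_card_lt {S T : Finset V} (h : T.card < S.card) : ∃ x ∈ S, x ∉ T := by
  by_contra! hcon
  exact absurd (Finset.card_le_card hcon) (by omega)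

/-- No two vertices cover all edges of an intersecting family of large minimum degree. -/
lemma Intersecting.exists_avoiding_pair {F : Finset (Finset V)} (hI : Intersecting F)
    {S : Finset V} (h3 : ∀ g ∈ F, g.card = 3) (hS : ∀ g ∈ F, g ⊆ S) (h7 : 7 ≤ S.card)
    (hdeg : ∀ v ∈ S, S.card - 1 ≤ (edgesAt F v).card) (x y : V) :
    ∃ g ∈ F, x ∉ g ∧ y ∉ g := by
  by_contra! hcov
  -- A common point `z` would give every other vertex degree at most `n - 2`.
  have star : ∀ z, ¬ ∀ g ∈ F, z ∈ g := by
    intro z hz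
    obtain ⟨w, hw, hwz⟩ := exists_mem_notMem_of_card_lt (S := S) (T := {z}) (by simp; omega)
    have := card_le_of_pair (G := edgesAt F w) (a := w) (b := z) (B := S) (by simpa using hwz) (by
      intro g hg
      rw [mem_edgesAt] at hg
      exact ⟨h3 g hg.1, hg.2, hz g hg.1, hS g hg.1⟩)
    have := hdeg w hw
    omega
  obtain ⟨α, hα, hyα⟩ : ∃ α ∈ F, y ∉ α := by simpa using star y
  obtain ⟨β, hβ, hxβ⟩ : ∃ β ∈ F, x ∉ β := by simpa using star x
  have hxα : x ∈ α := by
    by_contra h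
    exact hyα (hcov α hα h)
  have hyβ : y ∈ β := hcov β hβ hxβ
  have hcard : (α ∪ β).card ≤ 6 := by
    have := Finset.card_union_le α β
    rw [h3 α hα, h3 β hβ] at this
    exact this
  obtain ⟨w, hw, hwα⟩ := exists_mem_notMem_of_card_lt (S := S) (T := α ∪ β) (by omega)
  rw [Finset.mem_union, not_or] at hwα
  have hwx : w ≠ x := fun h => hwα.1 (h ▸ hxα)
  have hwy : w ≠ y := fun h => hwα.2 (h ▸ hyβ)
  have hle := card_le_add_of_forall_or (G := edgesAt F w) (fun g => x ∈ g)
    (fun g => x ∉ g ∧ y ∈ g) (by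
      intro g hg
      rw [mem_edgesAt] at hg
      by_cases h : x ∈ g
      · exact Or.inl h
      · exact Or.inr ⟨h, hcov g hg.1 h⟩)
  have meet : ∀ {u : V} {γ : Finset V}, γ ∈ F → u ∉ γ → w ∉ γ → w ≠ u → ∀ g ∈ F, w ∈ g → u ∈ g →
      g ⊆ insert w (insert u γ) := by
    intro u γ hγ huγ hwγ hwu g hg hwg hug
    obtain ⟨z, hzg, hzγ⟩ := Finset.not_disjoint_iff.1 (hI g hg γ hγ)
    rw [eq_of_mem_of_card_eq_three (h3 g hg) hwg hug hzg hwu (fun h => hwγ (h ▸ hzγ))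
      (fun h => huγ (h ▸ hzγ))]
    simp [Finset.insert_subset_iff, hzγ]
  -- Edges through `w` and `x` need a third vertex in `β`, giving at most 3. Those through `w` and
  -- `y` without `x` need one in `α` other than `x`, giving at most 2. The total 5 is below `n - 1 ≥
  -- 6`.
  have k1 := card_le_of_pair (G := (edgesAt F w).filter (fun g => x ∈ g)) (a := w) (b := x)
    (B := insert w (insert x β)) hwx (by
      intro g hg
      rw [Finset.mem_filter, mem_edgesAt] at hg
      exact ⟨h3 g hg.1.1, hg.1.2, hg.2, meet hβ hxβ hwα.2 hwx g hg.1.1 hg.1.2 hg.2⟩)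
  have k2 := card_le_of_pair (G := (edgesAt F w).filter (fun g => x ∉ g ∧ y ∈ g)) (a := w)
    (b := y) (B := (insert w (insert y α)).erase x) hwy (by
      intro g hg
      rw [Finset.mem_filter, mem_edgesAt] at hg
      exact ⟨h3 g hg.1.1, hg.1.2, hg.2.2, Finset.subset_erase.2
        ⟨meet hα hyα hwα.1 hwy g hg.1.1 hg.1.2 hg.2.2, hg.2.1⟩⟩)
  rw [Finset.card_erase_of_mem (by simp [hxα]), Finset.card_insert_of_notMem
    (by simp [hwα.1, hwy]), Finset.card_insert_of_notMem hyα, h3 α hα] at k2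
  rw [Finset.card_insert_of_notMem (by simp [hwα.2, hwx]), Finset.card_insert_of_notMem hxβ,
    h3 β hβ] at k1
  have := hdeg w hw
  omega

/-- An intersecting family of triples on `n ≥ 7` points has a point of degree at most `n - 2`. -/
lemma Intersecting.exists_card_edgesAt_lt {F : Finset (Finset V)} (hI : Intersecting F)
    {S : Finset V} (h3 : ∀ g ∈ F, g.card = 3) (hS : ∀ g ∈ F, g ⊆ S) (h7 : 7 ≤ S.card) :
    ∃ v ∈ S, (edgesAt F v).card < S.card - 1 := by
  by_contra! hdeg
  have hav : ∀ x y : V, ∃ g ∈ F, x ∉ g ∧ y ∉ g := hI.exists_avoiding_pair h3 hS h7 hdeg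
  obtain ⟨v, hv⟩ : S.Nonempty := Finset.card_pos.1 (by omega)
  obtain ⟨e, he⟩ : (edgesAt F v).Nonempty := Finset.card_pos.1 (by have := hdeg v hv; omega)
  rw [mem_edgesAt] at he
  obtain ⟨a, b, x, hab, hax, hbx, rfl⟩ := Finset.card_eq_three.1 (h3 e he.1)
  obtain ⟨g, hg, hag, hbg⟩ := hav a b
  have hxg : x ∈ g := by
    have := not_disjoint_triple.1 (hI g hg _ he.1)
    tauto
  obtain ⟨p, q, hxp, hxq, hpq, rfl⟩ := exists_eq_of_mem (h3 g hg) hxg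
  simp only [Finset.mem_insert, Finset.mem_singleton, not_or] at hag hbg
  have hcard : ({a, b, x, p, q} : Finset V).card ≤ 5 := Finset.card_le_five
  obtain ⟨r, hr, hr'⟩ := exists_mem_notMem_of_card_lt (S := S) (T := {a, b, x, p, q}) (by omega)
  obtain ⟨s, hs, hs'⟩ := exists_mem_notMem_of_card_lt (S := S) (T := {r, a, b, x, p, q}) (by
    have := Finset.card_insert_le r {a, b, x, p, q}
    omega)
  simp only [Finset.mem_insert, Finset.mem_singleton, not_or] at hr' hs'
  -- Some edge avoids `t` and `x`, so at most 3 edges contain both, leaving at least 6 - 3 = 3 at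
  -- `t` without `x`. Each of these meets `{a, b, x}` in `a` or `b` and `{x, p, q}` in `p` or `q`.
  have main : ∀ t ∈ S, t ≠ a → t ≠ b → t ≠ x → t ≠ p → t ≠ q →
      3 ≤ ((edgesAt F t).filter (fun g => x ∉ g)).card ∧
      (edgesAt F t).filter (fun g => x ∉ g) ⊆ {{t, a, p}, {t, b, q}, {t, a, q}, {t, b, p}} := by
    intro t ht hta htb htx htp htq
    constructor
    · obtain ⟨γ, hγ, htγ, hxγ⟩ := hav t x
      have k1 := card_le_of_pair (G := (edgesAt F t).filter (fun g => x ∈ g)) (a := t) (b := x)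
        (B := insert t (insert x γ)) htx (by
          intro g hg
          rw [Finset.mem_filter, mem_edgesAt] at hg
          obtain ⟨⟨hg, htg⟩, hxg⟩ := hg
          refine ⟨h3 g hg, htg, hxg, ?_⟩
          obtain ⟨z, hzg, hzγ⟩ := Finset.not_disjoint_iff.1 (hI g hg γ hγ)
          rw [eq_of_mem_of_card_eq_three (h3 g hg) htg hxg hzg htx (fun h => htγ (h ▸ hzγ))
            (fun h => hxγ (h ▸ hzγ))]
          simp [Finset.insert_subset_iff, hzγ])
      rw [Finset.card_insert_of_notMem (by simp [htγ, htx]), Finset.card_insert_of_notMem hxγ,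
        h3 γ hγ] at k1
      have k2 := Finset.card_filter_add_card_filter_not (s := edgesAt F t) (fun g => x ∈ g)
      have := hdeg t ht
      omega
    · intro g' hg'
      rw [Finset.mem_filter, mem_edgesAt] at hg'
      obtain ⟨⟨hgF, htg⟩, hxg'⟩ := hg'
      have i1 := not_disjoint_triple.1 (hI g' hgF _ he.1)
      have i2 := not_disjoint_triple.1 (hI g' hgF _ hg)
      have tri : ∀ {u w : V}, u ∈ g' → w ∈ g' → t ≠ u → t ≠ w → u ≠ w → g' = {t, u, w} :=
        fun hu hw h1 h2 h4 => eq_of_mem_of_card_eq_three (h3 g' hgF) htg hu hw h1 h2 h4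
      simp only [Finset.mem_insert, Finset.mem_singleton]
      rcases i1 with i1 | i1 | i1
      · rcases i2 with i2 | i2 | i2
        · exact absurd i2 hxg'
        · exact Or.inl (tri i1 i2 hta htp hag.2.1)
        · exact Or.inr (Or.inr (Or.inl (tri i1 i2 hta htq hag.2.2)))
      · rcases i2 with i2 | i2 | i2
        · exact absurd i2 hxg'
        · exact Or.inr (Or.inr (Or.inr (tri i1 i2 htb htp hbg.2.1)))
        · exact Or.inr (Or.inl (tri i1 i2 htb htq hbg.2.2))
      · exact absurd i1 hxg'
  obtain ⟨r1, r2⟩ := main r hr hr'.1 hr'.2.1 hr'.2.2.1 hr'.2.2.2.1 hr'.2.2.2.2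
  obtain ⟨s1, s2⟩ := main s hs hs'.2.1 hs'.2.2.1 hs'.2.2.2.1 hs'.2.2.2.2.1 hs'.2.2.2.2.2
  have two : ∀ (t : V) (A B : Finset V), 3 ≤ ((edgesAt F t).filter (fun g => x ∉ g)).card →
      ¬ ((edgesAt F t).filter (fun g => x ∉ g) ⊆ {A, B}) := by
    intro t A B h1 h2
    have := (Finset.card_le_card h2).trans Finset.card_le_two
    omega
  have mem : ∀ {t : V} {A : Finset V}, A ∈ (edgesAt F t).filter (fun g => x ∉ g) → A ∈ F :=
    fun h => (mem_edgesAt.1 (Finset.mem_filter.1 h).1).1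
  have hbad : ∀ {A B : Finset V}, A ∈ F → Disjoint B A → B ∉ F :=
    fun hA hd hB => hI _ hB _ hA hd
  -- Three of the four candidates at `r` must include two that meet only in `r`.
  have hopp : (({r, a, p} : Finset V) ∈ F ∧ ({r, b, q} : Finset V) ∈ F) ∨
      (({r, a, q} : Finset V) ∈ F ∧ ({r, b, p} : Finset V) ∈ F) := by
    by_contra! hcon
    obtain ⟨c1, c2⟩ := hcon
    by_cases d1 : ({r, a, p} : Finset V) ∈ F <;> by_cases d2 : ({r, a, q} : Finset V) ∈ F
    · refine two r {r, a, p} {r, a, q} r1 fun A hA => ?_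
      have := r2 hA
      have := mem hA
      simp only [Finset.mem_insert, Finset.mem_singleton] at *
      grind
    · refine two r {r, a, p} {r, b, p} r1 fun A hA => ?_
      have := r2 hA
      have := mem hA
      simp only [Finset.mem_insert, Finset.mem_singleton] at *
      grind
    · refine two r {r, b, q} {r, a, q} r1 fun A hA => ?_
      have := r2 hA
      have := mem hA
      simp only [Finset.mem_insert, Finset.mem_singleton] at *
      grind
    · refine two r {r, b, q} {r, b, p} r1 fun A hA => ?_
      have := r2 hA
      have := mem hA
      simp only [Finset.mem_insert, Finset.mem_singleton] at *
      grind
  -- The two edges found at `r` exclude two of the four candidates at `s`, which needs three.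
  rcases hopp with ⟨o1, o2⟩ | ⟨o1, o2⟩
  · refine two s {s, a, q} {s, b, p} s1 fun A hA => ?_
    have n1 : ({s, a, p} : Finset V) ∉ F := hbad o2 (by simp; grind)
    have n2 : ({s, b, q} : Finset V) ∉ F := hbad o1 (by simp; grind)
    have := s2 hA
    have := mem hA
    simp only [Finset.mem_insert, Finset.mem_singleton] at *
    grind
  · refine two s {s, a, p} {s, b, q} s1 fun A hA => ?_
    have n1 : ({s, a, q} : Finset V) ∉ F := hbad o2 (by simp; grind)
    have n2 : ({s, b, p} : Finset V) ∉ F := hbad o1 (by simp; grind)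
    have := s2 hA
    have := mem hA
    simp only [Finset.mem_insert, Finset.mem_singleton] at *
    grind

end Intersecting

/-! ### Vertices of low degree in path-free families -/

section MinimumDegree

variable {V : Type*} [DecidableEq V]

lemma edgesAt_subset_point_bound {F : Finset (Finset V)} (h3 : ∀ g ∈ F, g.card = 3) {v : V}
    {B : Finset V} (h : ∀ g ∈ F, v ∈ g → g ⊆ B) : (edgesAt F v).card ≤ (B.card - 1).choose 2 :=
  card_le_of_point (a := v) fun g hg => by
    rw [mem_edgesAt] at hg
    exact ⟨h3 g hg.1, hg.2, h g hg.1 hg.2⟩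

/-- If meeting is transitive on the edges, then the edges split into intersecting families on
disjoint sets of vertices. -/
lemma exists_card_edgesAt_lt_of_transitive {F : Finset (Finset V)} {S : Finset V}
    (h3 : ∀ g ∈ F, g.card = 3) (hS : ∀ g ∈ F, g ⊆ S) (h7 : 7 ≤ S.card)
    (htrans : ∀ e ∈ F, ∀ f ∈ F, ∀ g ∈ F, ¬ Disjoint g e → ¬ Disjoint g f → ¬ Disjoint e f) :
    ∃ v ∈ S, (edgesAt F v).card < S.card - 1 := by
  by_cases hI : Intersecting F
  · exact hI.exists_card_edgesAt_lt h3 hS h7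
  unfold Intersecting at hI
  push Not at hI
  obtain ⟨e, he, f, hf, hd⟩ := hI
  -- Transitivity makes the edges meeting `e` a component with support `U`, and degrees on `U` are
  -- computed within it.
  have small : ∀ e ∈ F, 2 * ((F.filter (fun g => ¬ Disjoint g e)).biUnion id).card ≤ S.card →
      ∃ v ∈ S, (edgesAt F v).card < S.card - 1 := by
    intro e he hle
    set G := F.filter (fun g => ¬ Disjoint g e) with hG
    set U := G.biUnion id with hU
    have hUS : U ⊆ S := by
      intro x hx
      obtain ⟨g, hg, hxg⟩ := Finset.mem_biUnion.1 hx
      exact hS g (Finset.mem_filter.1 hg).1 hxg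
    have hGU : ∀ g ∈ G, g ⊆ U := fun g hg x hx => Finset.mem_biUnion.2 ⟨g, hg, hx⟩
    have heG : e ∈ G := by
      refine Finset.mem_filter.2 ⟨he, fun h => ?_⟩
      have := h3 e he
      rw [disjoint_self.1 h] at this
      simp at this
    have hG3 : ∀ g ∈ G, g.card = 3 := fun g hg => h3 g (Finset.mem_filter.1 hg).1
    have hdeg : ∀ u ∈ U, edgesAt F u = edgesAt G u := by
      intro u hu
      obtain ⟨g, hg, hug⟩ := Finset.mem_biUnion.1 hu
      ext g'
      simp only [mem_edgesAt]
      constructor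
      · rintro ⟨hg', hug'⟩
        refine ⟨Finset.mem_filter.2 ⟨hg', ?_⟩, hug'⟩
        have hg := Finset.mem_filter.1 hg
        exact htrans g' hg' e he g hg.1 (Finset.not_disjoint_iff.2 ⟨u, hug, hug'⟩) hg.2
      · exact fun h => ⟨(Finset.mem_filter.1 h.1).1, h.2⟩
    have hGI : Intersecting G := by
      intro g hg g' hg'
      rw [hG, Finset.mem_filter] at hg hg'
      exact htrans g hg.1 g' hg'.1 e he (fun h => hg.2 h.symm) (fun h => hg'.2 h.symm)
    by_cases hU7 : 7 ≤ U.card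
    · obtain ⟨v, hv, hlt⟩ := hGI.exists_card_edgesAt_lt hG3 hGU hU7
      refine ⟨v, hUS hv, ?_⟩
      rw [hdeg v hv]
      omega
    · obtain ⟨v, hv⟩ : e.Nonempty := Finset.card_pos.1 (by rw [h3 e he]; norm_num)
      have hvU : v ∈ U := hGU e heG hv
      refine ⟨v, hUS hvU, ?_⟩
      rw [hdeg v hvU]
      have hb := edgesAt_subset_point_bound hG3 (v := v) (B := U) (fun g hg _ => hGU g hg)
      have hU6 : U.card ≤ 6 := by omega
      -- Equality holds at `|U| = 6`; this is why a component spanning at most half of `S` is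
      -- chosen.
      have hk : (U.card - 1).choose 2 ≤ 2 * U.card - 2 := by
        generalize U.card = k at hU6
        interval_cases k <;> decide
      omega
  by_cases hle : 2 * ((F.filter (fun g => ¬ Disjoint g e)).biUnion id).card ≤ S.card
  · exact small e he hle
  refine small f hf ?_
  have hdis : Disjoint ((F.filter (fun g => ¬ Disjoint g e)).biUnion id)
      ((F.filter (fun g => ¬ Disjoint g f)).biUnion id) := by
    rw [Finset.disjoint_left]
    intro x hx hx'
    obtain ⟨g, hg, hxg⟩ := Finset.mem_biUnion.1 hx
    obtain ⟨g', hg', hxg'⟩ := Finset.mem_biUnion.1 hx'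
    rw [Finset.mem_filter] at hg hg'
    have k1 : ¬ Disjoint e g' := htrans e he g' hg'.1 g hg.1 hg.2
      (Finset.not_disjoint_iff.2 ⟨x, hxg, hxg'⟩)
    exact htrans e he f hf g' hg'.1 (fun h => k1 h.symm) hg'.2 hd
  have hsub : (F.filter (fun g => ¬ Disjoint g e)).biUnion id ∪
      (F.filter (fun g => ¬ Disjoint g f)).biUnion id ⊆ S := by
    refine Finset.union_subset ?_ ?_ <;>
    · intro x hx
      obtain ⟨g, hg, hxg⟩ := Finset.mem_biUnion.1 hx
      exact hS g (Finset.mem_filter.1 hg).1 hxg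
  have := Finset.card_le_card hsub
  rw [Finset.card_union_of_disjoint hdis] at this
  omega

/-- The edges that meet `e` stay in `e ∪ f`. -/
def Closed (F : Finset (Finset V)) (e f : Finset V) : Prop :=
  ∀ g ∈ F, ¬ Disjoint g e → g ⊆ e ∪ f

/-- Edges that meet `f` do not split the pair `a, b` of `e = {a, b, c}`, unless they contain
exactly one vertex of `e`. -/
def Paired (F : Finset (Finset V)) (e f : Finset V) (a b c : V) : Prop :=
  a ≠ b ∧ a ≠ c ∧ b ≠ c ∧ e = {a, b, c} ∧ (∀ g ∈ F, Disjoint g f → (a ∈ g ↔ b ∈ g)) ∧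
    (∀ g ∈ F, ¬ Disjoint g f → c ∈ g → a ∉ g ∧ b ∉ g)

/-- Edges that meet `f` have at most one vertex in `e`. -/
def Separated (F : Finset (Finset V)) (e f : Finset V) : Prop :=
  ∀ g ∈ F, ∀ x ∈ e, ∀ y ∈ e, x ∈ g → y ∈ g → x ≠ y → Disjoint g f

variable {F : Finset (Finset V)} {S e f : Finset V}

lemma card_edgesAt_le_of_closed (h3 : ∀ g ∈ F, g.card = 3) (he : e ∈ F) (hf : f ∈ F)
    (hd : Disjoint e f) (hA : Closed F e f) {x : V} (hx : x ∈ e) : (edgesAt F x).card ≤ 10 := by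
  have := edgesAt_subset_point_bound h3 (v := x) (B := e ∪ f)
    (fun g hg hxg => hA g hg (Finset.not_disjoint_iff.2 ⟨x, hxg, hx⟩))
  rwa [Finset.card_union_of_disjoint hd, h3 e he, h3 f hf] at this

/-- If all degrees were at least `n - 1`, a vertex of `e`, of degree at most C(5,2) = 10, would
force `n ≤ 11`. A vertex outside `e ∪ f` only has edges outside it, so its degree is at most
C(n-7,2) ≤ 6. -/
lemma closed_closed (h3 : ∀ g ∈ F, g.card = 3) (hS : ∀ g ∈ F, g ⊆ S) (h8 : 8 ≤ S.card)
    (he : e ∈ F) (hf : f ∈ F) (hd : Disjoint e f) (hA : Closed F e f) (hA' : Closed F f e) :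
    ∃ v ∈ S, (edgesAt F v).card < S.card - 1 := by
  by_contra! hdeg
  obtain ⟨x, hx⟩ : e.Nonempty := Finset.card_pos.1 (by rw [h3 e he]; norm_num)
  have h11 := (hdeg x (hS e he hx)).trans (card_edgesAt_le_of_closed h3 he hf hd hA hx)
  have hW : (e ∪ f).card = 6 := by
    rw [Finset.card_union_of_disjoint hd, h3 e he, h3 f hf]
  obtain ⟨r, hr, hrW⟩ := exists_mem_notMem_of_card_lt (S := S) (T := e ∪ f) (by omega)
  have hb := edgesAt_subset_point_bound h3 (v := r) (B := S \ (e ∪ f)) (by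
    intro g hg hrg
    refine Finset.subset_sdiff.2 ⟨hS g hg, Finset.disjoint_union_right.2 ⟨?_, ?_⟩⟩
    · by_contra h
      exact hrW (hA g hg h hrg)
    · by_contra h
      exact hrW (Finset.union_comm f e ▸ hA' g hg h hrg))
  rw [Finset.card_sdiff_of_subset (Finset.union_subset (hS e he) (hS f hf)), hW] at hb
  have := hdeg r hr
  have h12 : S.card ≤ 11 := by omega
  have hk : (S.card - 6 - 1).choose 2 ≤ 6 := by
    generalize S.card = k at h8 h12
    interval_cases k <;> decide
  omega

/-- Every edge at `a ∈ e` contains a second vertex of `e`, as otherwise it would have two in `f`. So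
`a` has degree at most 4 + 3, forcing `n = 8`; then a vertex outside `e ∪ f` has degree at most
C(4,2) = 6. -/
lemma closed_separated (h3 : ∀ g ∈ F, g.card = 3) (hS : ∀ g ∈ F, g ⊆ S) (h8 : 8 ≤ S.card)
    (he : e ∈ F) (hf : f ∈ F) (hd : Disjoint e f) (hA : Closed F e f)
    (hC : Separated F f e) : ∃ v ∈ S, (edgesAt F v).card < S.card - 1 := by
  by_contra! hdeg
  obtain ⟨a, b, c, hab, hac, hbc, rfl⟩ := Finset.card_eq_three.1 (h3 e he)
  have hW : (({a, b, c} : Finset V) ∪ f).card = 6 := by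
    rw [Finset.card_union_of_disjoint hd, h3 _ he, h3 f hf]
  have hsub : ∀ g ∈ F, a ∈ g → g ⊆ {a, b, c} ∪ f := fun g hg hag =>
    hA g hg (not_disjoint_triple.2 (Or.inl hag))
  have hle := card_le_add_of_forall_or (G := edgesAt F a) (fun g => b ∈ g)
    (fun g => b ∉ g ∧ c ∈ g) (by
      intro g hg
      rw [mem_edgesAt] at hg
      by_contra! hcon
      obtain ⟨y, z, hay, haz, hyz, rfl⟩ := exists_eq_of_mem (h3 g hg.1) hg.2
      have hs := hsub _ hg.1 hg.2
      have hy : y ∈ f := by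
        have := hs (show y ∈ _ by simp)
        simp only [Finset.mem_union, Finset.mem_insert, Finset.mem_singleton] at this hcon
        grind
      have hz : z ∈ f := by
        have := hs (show z ∈ _ by simp)
        simp only [Finset.mem_union, Finset.mem_insert, Finset.mem_singleton] at this hcon
        grind
      have := hC _ hg.1 y hy z hz (by simp) (by simp) hyz
      exact Finset.disjoint_left.1 this (show a ∈ _ by simp) (by simp))
  have k1 := card_le_of_pair (G := (edgesAt F a).filter (fun g => b ∈ g))
    (B := {a, b, c} ∪ f) hab (by
      intro g hg
      rw [Finset.mem_filter, mem_edgesAt] at hg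
      exact ⟨h3 g hg.1.1, hg.1.2, hg.2, hsub g hg.1.1 hg.1.2⟩)
  have k2 := card_le_of_pair (G := (edgesAt F a).filter (fun g => b ∉ g ∧ c ∈ g))
    (B := ({a, b, c} ∪ f).erase b) hac (by
      intro g hg
      rw [Finset.mem_filter, mem_edgesAt] at hg
      exact ⟨h3 g hg.1.1, hg.1.2, hg.2.2, Finset.subset_erase.2 ⟨hsub g hg.1.1 hg.1.2, hg.2.1⟩⟩)
  rw [Finset.card_erase_of_mem (by simp)] at k2
  have := hdeg a (hS _ he (by simp))
  have hS8 : S.card = 8 := by omega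
  obtain ⟨r, hr, hrW⟩ := exists_mem_notMem_of_card_lt (S := S) (T := {a, b, c} ∪ f) (by omega)
  have hb := edgesAt_subset_point_bound h3 (v := r) (B := S \ {a, b, c}) (by
    intro g hg hrg
    refine Finset.subset_sdiff.2 ⟨hS g hg, ?_⟩
    by_contra h
    exact hrW (hA g hg h hrg))
  rw [Finset.card_sdiff_of_subset (hS _ he), h3 _ he, hS8] at hb
  have := hdeg r hr
  simp [Nat.choose] at hb
  omega

/-- The only possible edge at `a` without `b` and `c` is `{a, p, q}`, so `a` has degree at most 4 +
3 + 1 and `n ≤ 9`. Then `s` has low degree: at most 3 edges meet `e`, one is `f`, and the others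
avoid `e`, `p` and `q`, giving at most 3 + 1 + C(n-6,2) ≤ n - 2. -/
lemma closed_paired (h3 : ∀ g ∈ F, g.card = 3) (hS : ∀ g ∈ F, g ⊆ S) (h8 : 8 ≤ S.card)
    (he : e ∈ F) (hf : f ∈ F) (hd : Disjoint e f) (hA : Closed F e f)
    {p q s : V} (hB : Paired F f e p q s) : ∃ v ∈ S, (edgesAt F v).card < S.card - 1 := by
  by_contra! hdeg
  obtain ⟨hpq, hps, hqs, rfl, h1, h2⟩ := hB
  obtain ⟨a, b, c, hab, hac, hbc, rfl⟩ := Finset.card_eq_three.1 (h3 e he)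
  have hW : (({a, b, c} : Finset V) ∪ {p, q, s}).card = 6 := by
    rw [Finset.card_union_of_disjoint hd, h3 _ he, h3 _ hf]
  have hsub : ∀ g ∈ F, a ∈ g → g ⊆ {a, b, c} ∪ {p, q, s} := fun g hg hag =>
    hA g hg (not_disjoint_triple.2 (Or.inl hag))
  have hle := card_le_add_of_forall_or_or (G := edgesAt F a) (fun g => b ∈ g)
    (fun g => b ∉ g ∧ c ∈ g) (fun g => g ⊆ {a, p, q}) (by
      intro g hg
      rw [mem_edgesAt] at hg
      have hs := hsub g hg.1 hg.2
      have h4 := h2 g hg.1 (not_disjoint_triple.2 (Or.inl hg.2))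
      by_contra! hcon
      obtain ⟨hb, hc, hsp⟩ := hcon
      have hc := hc hb
      obtain ⟨y, z, hay, haz, hyz, rfl⟩ := exists_eq_of_mem (h3 g hg.1) hg.2
      apply hsp
      have hy := hs (show y ∈ _ by simp)
      have hz := hs (show z ∈ _ by simp)
      have ha1 : a ∉ ({p, q, s} : Finset V) := Finset.disjoint_left.1 hd (by simp)
      simp only [Finset.mem_union, Finset.mem_insert, Finset.mem_singleton,
        Finset.insert_subset_iff, Finset.singleton_subset_iff] at *
      grind)
  have k1 := card_le_of_pair (G := (edgesAt F a).filter (fun g => b ∈ g))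
    (B := {a, b, c} ∪ {p, q, s}) hab (by
      intro g hg
      rw [Finset.mem_filter, mem_edgesAt] at hg
      exact ⟨h3 g hg.1.1, hg.1.2, hg.2, hsub g hg.1.1 hg.1.2⟩)
  have k2 := card_le_of_pair (G := (edgesAt F a).filter (fun g => b ∉ g ∧ c ∈ g))
    (B := (({a, b, c} : Finset V) ∪ {p, q, s}).erase b) hac (by
      intro g hg
      rw [Finset.mem_filter, mem_edgesAt] at hg
      exact ⟨h3 g hg.1.1, hg.1.2, hg.2.2, Finset.subset_erase.2 ⟨hsub g hg.1.1 hg.1.2, hg.2.1⟩⟩)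
  have k3 := card_le_of_subset (G := (edgesAt F a).filter (fun g => g ⊆ {a, p, q}))
    (B := {a, p, q}) (by
      intro g hg
      rw [Finset.mem_filter, mem_edgesAt] at hg
      exact ⟨h3 g hg.1.1, hg.2⟩)
  have k4 := Nat.choose_le_choose 3 (Finset.card_le_three (a := a) (b := p) (c := q))
  rw [Nat.choose_self] at k4
  rw [Finset.card_erase_of_mem (by simp)] at k2
  have := hdeg a (hS _ he (by simp))
  have hs : s ∉ ({a, b, c} : Finset V) := Finset.disjoint_right.1 hd (by simp)
  have hT : ({a, b, c} : Finset V) ∪ {p, q} ⊆ S := by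
    refine (Finset.union_subset_union_right ?_).trans (Finset.union_subset (hS _ he) (hS _ hf))
    simp [Finset.insert_subset_iff]
  have hT5 : (({a, b, c} : Finset V) ∪ {p, q}).card = 5 := by
    rw [Finset.card_union_of_disjoint, h3 _ he, Finset.card_pair hpq]
    refine Finset.disjoint_of_subset_right ?_ hd
    simp [Finset.insert_subset_iff]
  have hle' := card_le_add_of_forall_or_or (G := edgesAt F s) (fun g => g ⊆ {s, a, b, c})
    (fun g => g ⊆ {p, q, s}) (fun g => g ⊆ S \ ({a, b, c} ∪ {p, q})) (by
      intro g hg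
      rw [mem_edgesAt] at hg
      by_cases hge : Disjoint g {a, b, c}
      · have h5 := h1 g hg.1 hge
        by_cases hpg : p ∈ g
        · right
          left
          rw [eq_of_mem_of_card_eq_three (h3 g hg.1) hpg (h5.1 hpg) hg.2 hpq hps hqs]
        · right
          right
          refine Finset.subset_sdiff.2 ⟨hS g hg.1, ?_⟩
          have : q ∉ g := fun h => hpg (h5.2 h)
          simp only [Finset.disjoint_union_right, Finset.disjoint_insert_right,
            Finset.disjoint_singleton_right] at hge ⊢
          exact ⟨hge, hpg, this⟩
      · left
        have h5 := hA g hg.1 hge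
        have h6 := h2 g hg.1 hge hg.2
        intro x hx
        have := h5 hx
        simp only [Finset.mem_union, Finset.mem_insert, Finset.mem_singleton] at *
        grind)
  have m1 := card_le_of_point (G := (edgesAt F s).filter (fun g => g ⊆ {s, a, b, c})) (a := s)
    (B := {s, a, b, c}) (by
      intro g hg
      rw [Finset.mem_filter, mem_edgesAt] at hg
      exact ⟨h3 g hg.1.1, hg.1.2, hg.2⟩)
  have m2 := card_le_of_subset (G := (edgesAt F s).filter (fun g => g ⊆ {p, q, s}))
    (B := {p, q, s}) (by
      intro g hg
      rw [Finset.mem_filter, mem_edgesAt] at hg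
      exact ⟨h3 g hg.1.1, hg.2⟩)
  have m3 := card_le_of_point
    (G := (edgesAt F s).filter (fun g => g ⊆ S \ ({a, b, c} ∪ {p, q}))) (a := s)
    (B := S \ ({a, b, c} ∪ {p, q})) (by
      intro g hg
      rw [Finset.mem_filter, mem_edgesAt] at hg
      exact ⟨h3 g hg.1.1, hg.1.2, hg.2⟩)
  rw [Finset.card_sdiff_of_subset hT, hT5] at m3
  rw [h3 _ hf, Nat.choose_self] at m2
  rw [Finset.card_insert_of_notMem hs, h3 _ he] at m1
  norm_num [Nat.choose] at m1
  have := hdeg s (hS _ hf (by simp))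
  have h12 : S.card ≤ 9 := by omega
  have hk : (S.card - 5 - 1).choose 2 ≤ S.card - 6 := by
    generalize S.card = k at h8 h12
    interval_cases k <;> decide
  omega

/-- Every edge at `a` contains `b`. An exception would meet `f`, lie in `e ∪ f` and avoid `c`, hence
have two vertices in `f`, contradicting separation. -/
lemma paired_separated (h3 : ∀ g ∈ F, g.card = 3) (hS : ∀ g ∈ F, g ⊆ S) (h8 : 8 ≤ S.card)
    (hP : PathFree F) (he : e ∈ F) (hf : f ∈ F) (hd : Disjoint e f) {a b c : V}
    (hB : Paired F e f a b c) (hC : Separated F f e) :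
    ∃ v ∈ S, (edgesAt F v).card < S.card - 1 := by
  obtain ⟨hab, hac, hbc, rfl, h1, h2⟩ := hB
  refine ⟨a, hS _ he (by simp), ?_⟩
  have := card_le_of_pair (G := edgesAt F a) (B := S) hab (by
    intro g hg
    rw [mem_edgesAt] at hg
    refine ⟨h3 g hg.1, hg.2, ?_, hS g hg.1⟩
    by_cases hgf : Disjoint g f
    · exact (h1 g hg.1 hgf).1 hg.2
    have hge : ¬ Disjoint g {a, b, c} := not_disjoint_triple.2 (Or.inl hg.2)
    have hs := hP _ he f hf g hg.1 hd hge hgf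
    have h4 := h2 g hg.1 hgf
    by_contra hbg
    have hcg : c ∉ g := fun h => (h4 h).1 hg.2
    obtain ⟨y, z, hay, haz, hyz, rfl⟩ := exists_eq_of_mem (h3 g hg.1) hg.2
    have hy := hs (show y ∈ _ by simp)
    have hz := hs (show z ∈ _ by simp)
    simp only [Finset.mem_union, Finset.mem_insert, Finset.mem_singleton] at hy hz hbg hcg
    exact hge (hC _ hg.1 y (by grind) z (by grind) (by simp) (by simp) hyz))
  omega

lemma Paired.eq_of_mem_third {a b c p q s : V} (hB : Paired F e f a b c)
    (hB' : Paired F f e p q s) (h3 : ∀ g ∈ F, g.card = 3) (hP : PathFree F) (he : e ∈ F)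
    (hf : f ∈ F) (hd : Disjoint e f) {g : Finset V} (hg : g ∈ F) (hcg : c ∈ g)
    (hgf : ¬ Disjoint g f) : g = {c, p, q} := by
  obtain ⟨hab, hac, hbc, rfl, h1, h2⟩ := hB
  obtain ⟨hpq, hps, hqs, rfl, h1', h2'⟩ := hB'
  have hge : ¬ Disjoint g {a, b, c} := not_disjoint_triple.2 (Or.inr (Or.inr hcg))
  have hs := hP _ he _ hf g hg hd hge hgf
  have h4 := h2 g hg hgf hcg
  have h5 := h2' g hg hge
  obtain ⟨y, z, hcy, hcz, hyz, rfl⟩ := exists_eq_of_mem (h3 g hg) hcg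
  have hy := hs (show y ∈ _ by simp)
  have hz := hs (show z ∈ _ by simp)
  simp only [Finset.mem_union, Finset.mem_insert, Finset.mem_singleton] at hy hz h4 h5
  have hyz' : (y = p ∧ z = q) ∨ (y = q ∧ z = p) := by
    clear * - hy hz h4 h5 hcy hcz hyz
    grind
  rcases hyz' with ⟨rfl, rfl⟩ | ⟨rfl, rfl⟩
  · rfl
  · rw [Finset.pair_comm]

lemma Paired.mem_or_eq_of_mem {a b c p q s : V} (hB : Paired F e f a b c)
    (hB' : Paired F f e p q s) (h3 : ∀ g ∈ F, g.card = 3) (hP : PathFree F) (he : e ∈ F)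
    (hf : f ∈ F) (hd : Disjoint e f) {g : Finset V} (hg : g ∈ F) (hpg : p ∈ g) :
    q ∈ g ∨ g = {a, b, p} := by
  obtain ⟨hab, hac, hbc, rfl, h1, h2⟩ := hB
  obtain ⟨hpq, hps, hqs, rfl, h1', h2'⟩ := hB'
  by_cases hge : Disjoint g {a, b, c}
  · exact Or.inl ((h1' g hg hge).1 hpg)
  have hgf : ¬ Disjoint g {p, q, s} := not_disjoint_triple.2 (Or.inl hpg)
  have hs := hP _ he _ hf g hg hd hge hgf
  have h4 := h2 g hg hgf
  have h5 := h2' g hg hge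
  by_contra! hcon
  obtain ⟨hq, hne⟩ := hcon
  apply hne
  obtain ⟨y, z, hpy, hpz, hyz, rfl⟩ := exists_eq_of_mem (h3 g hg) hpg
  have hy := hs (show y ∈ _ by simp)
  have hz := hs (show z ∈ _ by simp)
  simp only [Finset.mem_union, Finset.mem_insert, Finset.mem_singleton] at hy hz h4 h5 hq
  have hyz' : (y = a ∧ z = b) ∨ (y = b ∧ z = a) := by
    clear * - hy hz h4 h5 hq hpy hpz hyz
    grind
  have hdis : ∀ x ∈ ({a, b, c} : Finset V), x ≠ p :=
    fun x hx h => Finset.disjoint_left.1 hd hx (by simp [h])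
  refine eq_of_mem_of_card_eq_three (h3 _ hg) ?_ ?_ hpg hab (hdis a (by simp))
    (hdis b (by simp))
  · rcases hyz' with ⟨h, -⟩ | ⟨-, h⟩ <;> simp [h]
  · rcases hyz' with ⟨-, h⟩ | ⟨h, -⟩ <;> simp [h]

/-- Edges at `p` contain `q`, with the one possible exception `{a, b, p}`. This already gives degree
at most `n - 1`; one more edge is saved because `{a, b, p}` and `{c, p, q}` cannot both be present.
-/
lemma paired_paired (h3 : ∀ g ∈ F, g.card = 3) (hS : ∀ g ∈ F, g ⊆ S) (h8 : 8 ≤ S.card)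
    (hP : PathFree F) (he : e ∈ F) (hf : f ∈ F) (hd : Disjoint e f) {a b c p q s : V}
    (hB : Paired F e f a b c) (hB' : Paired F f e p q s) :
    ∃ v ∈ S, (edgesAt F v).card < S.card - 1 := by
  by_contra! hdeg
  have hpair := hB
  have hpair' := hB'
  obtain ⟨hab, hac, hbc, rfl, h1, h2⟩ := hpair
  obtain ⟨hpq, hps, hqs, rfl, h1', h2'⟩ := hpair'
  have hdis : ∀ x ∈ ({a, b, c} : Finset V), ∀ y ∈ ({p, q, s} : Finset V), x ≠ y :=
    fun x hx y hy h => Finset.disjoint_left.1 hd hx (h ▸ hy)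
  have hcp : c ≠ p := hdis c (by simp) p (by simp)
  have hcq : c ≠ q := hdis c (by simp) q (by simp)
  have hap : a ≠ p := hdis a (by simp) p (by simp)
  have hbp : b ≠ p := hdis b (by simp) p (by simp)
  obtain ⟨g, hg, hgne⟩ := exists_mem_notMem_of_card_lt (S := edgesAt F c)
    (T := {{a, b, c}, {c, p, q}}) (by
      have := hdeg c (hS _ he (by simp))
      have := Finset.card_le_two (a := ({a, b, c} : Finset V)) (b := {c, p, q})
      omega)
  rw [mem_edgesAt] at hg
  obtain ⟨hg, hcg⟩ := hg
  simp only [Finset.mem_insert, Finset.mem_singleton, not_or] at hgne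
  have hgf : Disjoint g {p, q, s} := by
    by_contra hgf
    exact hgne.2 (hB.eq_of_mem_third hB' h3 hP he hf hd hg hcg hgf)
  have hag : a ∉ g := fun h => hgne.1
    (eq_of_mem_of_card_eq_three (h3 g hg) h ((h1 g hg hgf).1 h) hcg hab hac hbc)
  have hbg : b ∉ g := fun h => hag ((h1 g hg hgf).2 h)
  rw [disjoint_comm] at hgf
  simp only [Finset.disjoint_insert_left, Finset.disjoint_singleton_left] at hgf
  -- Otherwise `g`, `{c, p, q}`, `{a, b, p}` would form a linear path.
  have hnot : ({a, b, p} : Finset V) ∉ F ∨ ({c, p, q} : Finset V) ∉ F := by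
    by_contra! hcon
    have := hP g hg _ hcon.1 _ hcon.2 (by
      rw [disjoint_comm]
      simp [hag, hbg, hgf.1]) (Finset.not_disjoint_iff.2 ⟨c, by simp, hcg⟩)
      (Finset.not_disjoint_iff.2 ⟨p, by simp, by simp⟩) (show q ∈ _ by simp)
    simp only [Finset.mem_union, Finset.mem_insert, Finset.mem_singleton, hgf.2.1, false_or]
      at this
    rcases this with h | h | h
    · exact hdis a (by simp) q (by simp) h.symm
    · exact hdis b (by simp) q (by simp) h.symm
    · exact hpq h.symm
  have hpedge : ∀ g ∈ F, p ∈ g → q ∈ g ∨ g = {a, b, p} :=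
    fun g hg hpg => hB.mem_or_eq_of_mem hB' h3 hP he hf hd hg hpg
  have hp := hdeg p (hS _ hf (by simp))
  rcases hnot with h | h
  · have := card_le_of_pair (G := edgesAt F p) (B := S) hpq (by
      intro g hg
      rw [mem_edgesAt] at hg
      refine ⟨h3 g hg.1, hg.2, (hpedge g hg.1 hg.2).resolve_right ?_, hS g hg.1⟩
      rintro rfl
      exact h hg.1)
    omega
  -- With `{c, p, q}` absent, the third vertex of an edge through `p` and `q` is not `c`: at most `n
  -- - 3` such edges, plus the exception.
  · have hle := card_le_add_of_forall_or (G := edgesAt F p) (fun g => q ∈ g)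
      (fun g => g = {a, b, p}) (by
        intro g hg
        rw [mem_edgesAt] at hg
        exact hpedge g hg.1 hg.2)
    have k1 := card_le_of_pair (G := (edgesAt F p).filter (fun g => q ∈ g)) (B := S.erase c) hpq (by
      intro g hg
      rw [Finset.mem_filter, mem_edgesAt] at hg
      refine ⟨h3 g hg.1.1, hg.1.2, hg.2, Finset.subset_erase.2 ⟨hS g hg.1.1, fun hcg => ?_⟩⟩
      exact h (eq_of_mem_of_card_eq_three (h3 g hg.1.1) hcg hg.1.2 hg.2 hcp hcq hpq ▸ hg.1.1))
    have k2 : ((edgesAt F p).filter (fun g => g = {a, b, p})).card ≤ 1 := by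
      refine Finset.card_le_one.2 fun x hx y hy => ?_
      rw [(Finset.mem_filter.1 hx).2, (Finset.mem_filter.1 hy).2]
    rw [Finset.card_erase_of_mem (hS _ he (by simp))] at k1
    omega

/-- A path-free family of triples on `n ≥ 8` points has a point of degree at most `n - 2`. -/
lemma PathFree.exists_card_edgesAt_lt (hP : PathFree F) (h3 : ∀ g ∈ F, g.card = 3)
    (hS : ∀ g ∈ F, g ⊆ S) (h8 : 8 ≤ S.card) : ∃ v ∈ S, (edgesAt F v).card < S.card - 1 := by
  by_cases htrans : ∀ e ∈ F, ∀ f ∈ F, ∀ g ∈ F, ¬ Disjoint g e → ¬ Disjoint g f → ¬ Disjoint e f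
  · exact exists_card_edgesAt_lt_of_transitive h3 hS (by omega) htrans
  push Not at htrans
  obtain ⟨e, he, f, hf, h, hh, hhe, hhf, hd⟩ := htrans
  have hU := Finset.union_comm e f
  rcases hP.trichotomy h3 he hf hd with hA | ⟨a, b, c, hB⟩ | hC
  · rcases hP.trichotomy h3 hf he hd.symm with hA' | ⟨p, q, s, hB'⟩ | hC'
    · exact closed_closed h3 hS h8 he hf hd hA hA'
    · exact closed_paired h3 hS h8 he hf hd hA hB'
    · exact closed_separated h3 hS h8 he hf hd hA hC'
  · rcases hP.trichotomy h3 hf he hd.symm with hA' | ⟨p, q, s, hB'⟩ | hC'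
    · exact closed_paired h3 hS h8 hf he hd.symm hA' hB
    · exact paired_paired h3 hS h8 hP he hf hd hB hB'
    · exact paired_separated h3 hS h8 hP he hf hd hB hC'
  · rcases hP.trichotomy h3 hf he hd.symm with hA' | ⟨p, q, s, hB'⟩ | hC'
    · exact closed_separated h3 hS h8 hf he hd.symm hA' hC
    · exact paired_separated h3 hS h8 hP hf he hd.symm hB' hC
    -- The connecting edge `h` lies in `e ∪ f`, so it has two vertices in one of them while meeting
    -- the other.
    · exfalso
      have hs := hP e he f hf h hh hd hhe hhf
      obtain ⟨x, hx, hxe⟩ := Finset.not_disjoint_iff.1 hhe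
      obtain ⟨y, z, hxy, hxz, hyz, rfl⟩ := exists_eq_of_mem (h3 h hh) hx
      rcases Finset.mem_union.1 (hs (show y ∈ _ by simp)) with hy | hy
      · exact hhf (hC _ hh x hxe y hy (by simp) (by simp) hxy)
      rcases Finset.mem_union.1 (hs (show z ∈ _ by simp)) with hz | hz
      · exact hhf (hC _ hh x hxe z hz (by simp) (by simp) hxz)
      exact hhe (hC' _ hh y hy z hz (by simp) (by simp) hyz)

end MinimumDegree

/-! ### Upper bounds for the number of edges -/

lemma Intersecting.mono {V : Type*} {F G : Finset (Finset V)} (hI : Intersecting F) (h : G ⊆ F) :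
    Intersecting G :=
  fun e he f hf => hI e (h he) f (h hf)

section Bounds

variable {V : Type*} [DecidableEq V] {F : Finset (Finset V)} {S : Finset V}

lemma PathFree.mono {G : Finset (Finset V)} (hP : PathFree F) (h : G ⊆ F) : PathFree G :=
  fun e he f hf g hg => hP e (h he) f (h hf) g (h hg)

lemma filter_notMem_subset_erase (hS : ∀ g ∈ F, g ⊆ S) (v : V) :
    ∀ g ∈ F.filter (fun g => v ∉ g), g ⊆ S.erase v := fun g hg =>
  Finset.subset_erase.2 ⟨hS g (Finset.mem_filter.1 hg).1, (Finset.mem_filter.1 hg).2⟩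

/-- Deletion of a vertex of small degree from a path-free family without a common vertex. -/
lemma PathFree.card_lt_of_erase (hP : PathFree F) (h3 : ∀ g ∈ F, g.card = 3)
    (hS : ∀ g ∈ F, g ⊆ S) (h8 : 8 ≤ S.card) (hns : ¬ ∃ c, ∀ g ∈ F, c ∈ g) {v : V} (hv : v ∈ S)
    (hdeg : (edgesAt F v).card < S.card - 1)
    (hrec : (¬ ∃ c, ∀ g ∈ F.filter (fun g => v ∉ g), c ∈ g) →
      (F.filter (fun g => v ∉ g)).card < (S.card - 2).choose 2) :
    F.card < (S.card - 1).choose 2 := by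
  have hsplit := card_edgesAt_add (F := F) v
  suffices h : (F.filter (fun g => v ∉ g)).card < (S.card - 2).choose 2 by
    obtain ⟨m, hm⟩ : ∃ m, S.card = m + 2 := ⟨S.card - 2, by omega⟩
    rw [hm] at h hdeg ⊢
    have hc : (m + 2 - 1).choose 2 = m.choose 1 + m.choose 2 := Nat.choose_succ_succ m 1
    rw [Nat.choose_one_right] at hc
    simp only [Nat.add_sub_cancel] at h
    omega
  by_cases hstar : ∃ c, ∀ g ∈ F.filter (fun g => v ∉ g), c ∈ g
  swap
  · exact hrec hstar
  obtain ⟨c, hc⟩ := hstar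
  by_contra! hge
  have hpos : 0 < (S.card - 2).choose 2 := Nat.choose_pos (by omega)
  obtain ⟨γ, hγ⟩ : (F.filter (fun g => v ∉ g)).Nonempty := Finset.card_pos.1 (by omega)
  have hcS : c ∈ S := hS γ (Finset.mem_filter.1 hγ).1 (hc γ hγ)
  -- A star that reaches C(n-2,2) edges is the full star on `S \ {v}`.
  have hfull : F.filter (fun g => v ∉ g) =
      ((S.erase v).powersetCard 3).filter (fun g => c ∈ g) := by
    apply Finset.eq_of_subset_of_card_le
    · intro g hg
      exact Finset.mem_filter.2 ⟨Finset.mem_powersetCard.2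
        ⟨filter_notMem_subset_erase hS v g hg, h3 g (Finset.mem_filter.1 hg).1⟩, hc g hg⟩
    · refine (card_le_of_point (a := c) (B := S.erase v) fun g hg => ?_).trans ?_
      · rw [Finset.mem_filter, Finset.mem_powersetCard] at hg
        exact ⟨hg.1.2, hg.2, hg.1.1⟩
      · rw [Finset.card_erase_of_mem hv]
        exact hge
  have hmem : ∀ x y, x ∈ S → y ∈ S → x ≠ v → y ≠ v → c ≠ v → c ≠ x → c ≠ y → x ≠ y →
      ({c, x, y} : Finset V) ∈ F := by
    intro x y hx hy hxv hyv hcv hcx hcy hxy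
    refine (Finset.mem_filter.1 (hfull.symm ▸ Finset.mem_filter.2
      ⟨Finset.mem_powersetCard.2 ⟨?_, ?_⟩, ?_⟩ : ({c, x, y} : Finset V) ∈ _)).1
    · simp [Finset.insert_subset_iff, *]
    · exact Finset.card_eq_three.2 ⟨c, x, y, hcx, hcy, hxy, rfl⟩
    · simp
  obtain ⟨g, hg, hcg⟩ : ∃ g ∈ F, c ∉ g := by simpa using fun h => hns ⟨c, h⟩
  have hvg : v ∈ g := by
    by_contra h
    exact hcg (hc g (Finset.mem_filter.2 ⟨hg, h⟩))
  obtain ⟨a, b, hva, hvb, hab, rfl⟩ := exists_eq_of_mem (h3 g hg) hvg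
  have hle : ({c, v, a, b} : Finset V).card ≤ 4 := Finset.card_le_four
  obtain ⟨t, ht, ht3⟩ := Finset.exists_subset_card_eq
    (show 3 ≤ (S \ {c, v, a, b}).card by
      have := Finset.le_card_sdiff {c, v, a, b} S
      omega)
  obtain ⟨x, y, z, hxy, hxz, hyz, rfl⟩ := Finset.card_eq_three.1 ht3
  simp only [Finset.insert_subset_iff, Finset.singleton_subset_iff, Finset.mem_sdiff,
    Finset.mem_insert, Finset.mem_singleton, not_or] at ht hcg
  obtain ⟨⟨hx, hxc, hxv, hxa, hxb⟩, ⟨hy, hyc, hyv, hya, hyb⟩, hz, hzc, hzv, hza, hzb⟩ := ht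
  have haS : a ∈ S := hS _ hg (by simp)
  -- The linear path `{v, a, b}`, `{a, c, x}`, `{c, y, z}` is the contradiction.
  have := hP _ (hmem y z hy hz hyv hzv hcg.1 (Ne.symm hyc) (Ne.symm hzc) hyz) _ hg _
    (hmem a x haS hx hva.symm hxv hcg.1 hcg.2.1 (Ne.symm hxc) (Ne.symm hxa))
    (by
      simp only [Finset.disjoint_insert_left, Finset.disjoint_singleton_left, Finset.mem_insert,
        Finset.mem_singleton, not_or]
      exact ⟨hcg, ⟨hyv, hya, hyb⟩, hzv, hza, hzb⟩)
    (Finset.not_disjoint_iff.2 ⟨c, by simp, by simp⟩)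
    (Finset.not_disjoint_iff.2 ⟨a, by simp, by simp⟩) (show x ∈ _ by simp)
  simp [hxc, hxy, hxz, hxv, hxa, hxb] at this

/-- An intersecting family of triples of a six-element set contains at most one triple of each
complementary pair. -/
lemma Intersecting.card_le_ten (hI : Intersecting F) (h3 : ∀ g ∈ F, g.card = 3)
    (hS : ∀ g ∈ F, g ⊆ S) (h6 : S.card = 6) :
    F.card ≤ 10 ∧ (F.card = 10 → ∀ T ⊆ S, T.card = 3 → T ∈ F ∨ S \ T ∈ F) := by
  have hinj : (F.image (fun g => S \ g)).card = F.card := by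
    refine Finset.card_image_of_injOn fun g hg g' hg' h => ?_
    have h : S \ g = S \ g' := h
    rw [← Finset.sdiff_sdiff_eq_self (hS g hg), h, Finset.sdiff_sdiff_eq_self (hS g' hg')]
  have hdis : Disjoint F (F.image (fun g => S \ g)) := by
    rw [Finset.disjoint_left]
    intro g hg hgi
    obtain ⟨g', hg', rfl⟩ := Finset.mem_image.1 hgi
    exact hI _ hg _ hg' Finset.sdiff_disjoint
  have hsub : F ∪ F.image (fun g => S \ g) ⊆ S.powersetCard 3 := by
    refine Finset.union_subset (fun g hg => Finset.mem_powersetCard.2 ⟨hS g hg, h3 g hg⟩) ?_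
    intro g hg
    obtain ⟨g', hg', rfl⟩ := Finset.mem_image.1 hg
    refine Finset.mem_powersetCard.2 ⟨Finset.sdiff_subset, ?_⟩
    rw [Finset.card_sdiff_of_subset (hS g' hg'), h6, h3 g' hg']
  have hcard : (F ∪ F.image (fun g => S \ g)).card = F.card + F.card := by
    rw [Finset.card_union_of_disjoint hdis, hinj]
  have h20 : (S.powersetCard 3).card = 20 := by
    rw [Finset.card_powersetCard, h6]
    rfl
  have hle := Finset.card_le_card hsub
  refine ⟨by omega, fun h10 T hT hT3 => ?_⟩
  have heq := Finset.eq_of_subset_of_card_le hsub (by omega)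
  have hTm : T ∈ S.powersetCard 3 := Finset.mem_powersetCard.2 ⟨hT, hT3⟩
  rw [← heq, Finset.mem_union] at hTm
  refine hTm.imp_right fun h => ?_
  obtain ⟨g, hg, rfl⟩ := Finset.mem_image.1 h
  rwa [Finset.sdiff_sdiff_eq_self (hS g hg)]

/-- If pairwise any two of more than three triples through `v` share another vertex, then they
all share another vertex. -/
lemma exists_common_of_pairwise {v : V} {G : Finset (Finset V)} (h3 : ∀ g ∈ G, g.card = 3)
    (hv : ∀ g ∈ G, v ∈ g) (h4 : 3 < G.card)
    (hpair : ∀ g ∈ G, ∀ g' ∈ G, ∃ u, u ≠ v ∧ u ∈ g ∧ u ∈ g') :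
    ∃ u, u ≠ v ∧ ∀ g ∈ G, u ∈ g := by
  obtain ⟨g₁, hg₁, g₂, hg₂, hne⟩ := Finset.one_lt_card.1 (show 1 < G.card by omega)
  obtain ⟨u, huv, hu₁, hu₂⟩ := hpair g₁ hg₁ g₂ hg₂
  obtain ⟨w, hvw, huw, rfl⟩ := exists_eq_of_mem_of_mem (h3 _ hg₁) (hv _ hg₁) hu₁ huv.symm
  obtain ⟨z, hvz, huz, rfl⟩ := exists_eq_of_mem_of_mem (h3 _ hg₂) (hv _ hg₂) hu₂ huv.symm
  have hwz : w ≠ z := fun h => hne (by rw [h])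
  refine ⟨u, huv, ?_⟩
  by_contra! hcon
  obtain ⟨h, hh, huh⟩ := hcon
  have avoid : ∀ g ∈ G, u ∉ g → g = {v, w, z} := by
    intro g hg hug
    obtain ⟨x, hxv, hx, hxg⟩ := hpair _ hg₁ g hg
    obtain ⟨y, hyv, hy, hyg⟩ := hpair _ hg₂ g hg
    simp only [Finset.mem_insert, Finset.mem_singleton] at hx hy
    have hwg : w ∈ g := by
      rcases hx with rfl | rfl | rfl
      · exact absurd rfl hxv
      · exact absurd hxg hug
      · exact hxg
    have hzg : z ∈ g := by
      rcases hy with rfl | rfl | rfl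
      · exact absurd rfl hyv
      · exact absurd hyg hug
      · exact hyg
    exact eq_of_mem_of_card_eq_three (h3 g hg) (hv g hg) hwg hzg hvw hvz hwz
  -- An edge avoiding `u` closes the triangle `u, w, z` in the link of `v`, and a triangle allows
  -- only three edges.
  have hsub : G ⊆ {{v, u, w}, {v, u, z}, {v, w, z}} := by
    intro g hg
    simp only [Finset.mem_insert, Finset.mem_singleton]
    by_cases hug : u ∈ g
    · obtain ⟨x, hxv, hx, hxg⟩ := hpair h hh g hg
      rw [avoid h hh huh] at hx
      simp only [Finset.mem_insert, Finset.mem_singleton] at hx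
      rcases hx with rfl | rfl | rfl
      · exact absurd rfl hxv
      · exact Or.inl (eq_of_mem_of_card_eq_three (h3 g hg) (hv g hg) hug hxg huv.symm hvw huw)
      · exact Or.inr (Or.inl
          (eq_of_mem_of_card_eq_three (h3 g hg) (hv g hg) hug hxg huv.symm hvz huz))
    · exact Or.inr (Or.inr (avoid g hg hug))
  have := (Finset.card_le_card hsub).trans Finset.card_le_three
  omega

/-- An intersecting family of triples on seven points has at most fifteen members, with equality
only if its members have a common point. -/
lemma Intersecting.card_le_fifteen (hI : Intersecting F) (h3 : ∀ g ∈ F, g.card = 3)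
    (hS : ∀ g ∈ F, g ⊆ S) (h7 : S.card = 7) :
    F.card ≤ 15 ∧ ((¬ ∃ c, ∀ g ∈ F, c ∈ g) → F.card < 15) := by
  obtain ⟨v, hv, hdeg⟩ := hI.exists_card_edgesAt_lt h3 hS h7.ge
  have hsplit := card_edgesAt_add (F := F) v
  have hX : (S.erase v).card = 6 := by rw [Finset.card_erase_of_mem hv, h7]
  obtain ⟨k1, k2⟩ := (hI.mono (Finset.filter_subset (fun g => v ∉ g) F)).card_le_ten
    (fun g hg => h3 g (Finset.mem_filter.1 hg).1) (filter_notMem_subset_erase hS v) hX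
  refine ⟨by omega, fun hns => ?_⟩
  by_contra! h15
  -- Fifteen edges force equality: degree 5 at `v`, and one triple of each complementary pair of `S
  -- \ {v}`.
  have hten := k2 (by omega)
  obtain ⟨u, huv, hu⟩ := exists_common_of_pairwise (v := v) (G := edgesAt F v)
    (fun g hg => h3 g (mem_edgesAt.1 hg).1) (fun g hg => (mem_edgesAt.1 hg).2) (by omega) (by
      intro g hg g' hg'
      by_contra! hcon
      rw [mem_edgesAt] at hg hg'
      obtain ⟨a, b, hva, hvb, hab, rfl⟩ := exists_eq_of_mem (h3 g hg.1) hg.2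
      have hc : (({v, a, b} : Finset V) ∪ g').card ≤ 6 := by
        have := Finset.card_union_le ({v, a, b} : Finset V) g'
        rw [h3 _ hg.1, h3 _ hg'.1] at this
        exact this
      obtain ⟨p, hp, hp'⟩ := exists_mem_notMem_of_card_lt (S := S) (T := {v, a, b} ∪ g')
        (by omega)
      simp only [Finset.mem_union, Finset.mem_insert, Finset.mem_singleton, not_or] at hp'
      have hag' : a ∉ g' := hcon a hva.symm (by simp)
      have hbg' : b ∉ g' := hcon b hvb.symm (by simp)
      have haS : a ∈ S := hS _ hg.1 (by simp)
      have hbS : b ∈ S := hS _ hg.1 (by simp)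
      -- Here `{a, b, p}` misses `g'`, while its complement in `S \ {v}` misses `{v, a, b}`.
      rcases hten {a, b, p} (by
          simp [Finset.insert_subset_iff, haS, hbS, hp, hva.symm, hvb.symm, hp'.1.1])
        (Finset.card_eq_three.2 ⟨a, b, p, hab, Ne.symm hp'.1.2.1, Ne.symm hp'.1.2.2, rfl⟩)
        with h | h
      · refine hI _ (Finset.mem_filter.1 h).1 _ hg'.1 ?_
        simp [hag', hbg', hp'.2]
      · refine hI _ (Finset.mem_filter.1 h).1 _ hg.1 ?_
        simp [Finset.disjoint_insert_right])
  obtain ⟨T, hT, huT⟩ : ∃ T ∈ F, u ∉ T := by simpa using fun h => hns ⟨u, h⟩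
  have hvT : v ∉ T := fun h => huT (hu T (mem_edgesAt.2 ⟨hT, h⟩))
  -- Each edge at `v` contains `u` and a point of `T`, so there are at most 3, not 5.
  have := card_le_of_pair (G := edgesAt F v) (B := insert v (insert u T)) huv.symm (by
    intro g hg
    have hug := hu g hg
    rw [mem_edgesAt] at hg
    refine ⟨h3 g hg.1, hg.2, hug, ?_⟩
    obtain ⟨z, hzg, hzT⟩ := Finset.not_disjoint_iff.1 (hI g hg.1 T hT)
    rw [eq_of_mem_of_card_eq_three (h3 g hg.1) hg.2 hug hzg huv.symm (fun h => hvT (h ▸ hzT))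
      (fun h => huT (h ▸ hzT))]
    simp [Finset.insert_subset_iff, hzT])
  rw [Finset.card_insert_of_notMem (by simp [hvT, huv.symm]), Finset.card_insert_of_notMem huT,
    h3 T hT] at this
  omega

/-- A path-free family of triples on seven points has at most twenty members, with equality only
if one of the points is isolated. -/
theorem PathFree.card_le_of_seven (hP : PathFree F) (h3 : ∀ g ∈ F, g.card = 3)
    (hS : ∀ g ∈ F, g ⊆ S) (h7 : S.card = 7) :
    F.card ≤ 20 ∧ (F.card = 20 → ∃ W : Finset V, W.card = 6 ∧ F = W.powersetCard 3) := by
  by_cases hI : Intersecting F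
  · have := (hI.card_le_fifteen h3 hS h7).1
    exact ⟨by omega, fun h => by omega⟩
  unfold Intersecting at hI
  push Not at hI
  obtain ⟨e, he, f, hf, hd⟩ := hI
  obtain ⟨k1, k2⟩ := hP.card_le_twenty h3 hS he hf hd (by omega)
  have hW : (e ∪ f).card = 6 := by rw [Finset.card_union_of_disjoint hd, h3 e he, h3 f hf]
  refine ⟨k1, fun h20 => ⟨e ∪ f, hW, Finset.eq_of_subset_of_card_le
    (fun g hg => Finset.mem_powersetCard.2 ⟨k2 h7 h20 g hg, h3 g hg⟩) ?_⟩⟩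
  rw [Finset.card_powersetCard, hW, h20]
  rfl

/-- A path-free family of triples on `n ≥ 8` points without a common point has fewer members than
the full star. -/
theorem PathFree.card_lt_of_not_star (hP : PathFree F) (h3 : ∀ g ∈ F, g.card = 3)
    (hS : ∀ g ∈ F, g ⊆ S) (h8 : 8 ≤ S.card) (hns : ¬ ∃ c, ∀ g ∈ F, c ∈ g) :
    F.card < (S.card - 1).choose 2 := by
  obtain ⟨n, hn⟩ : ∃ n, S.card = n := ⟨_, rfl⟩
  rw [hn] at h8
  induction n, h8 using Nat.le_induction generalizing F S with
  | base =>
    -- The bound needed after deletion is C(6,2) = 15 on seven points, which holds for intersecting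
    -- families only.
    by_cases hI : Intersecting F
    · obtain ⟨v, hv, hdeg⟩ := hI.exists_card_edgesAt_lt h3 hS (by omega)
      refine hP.card_lt_of_erase h3 hS hn.ge hns hv hdeg ?_
      rw [hn]
      exact ((hI.mono (Finset.filter_subset (fun g => v ∉ g) F)).card_le_fifteen
        (fun g hg => h3 g (Finset.mem_filter.1 hg).1) (filter_notMem_subset_erase hS v)
        (by rw [Finset.card_erase_of_mem hv, hn])).2
    · unfold Intersecting at hI
      push Not at hI
      obtain ⟨e, he, f, hf, hd⟩ := hI
      have := (hP.card_le_twenty h3 hS he hf hd hn.le).1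
      have h21 : (S.card - 1).choose 2 = 21 := by
        rw [hn]
        rfl
      omega
  | succ n h8 ih =>
    obtain ⟨v, hv, hdeg⟩ := hP.exists_card_edgesAt_lt h3 hS (by omega)
    refine hP.card_lt_of_erase h3 hS (by omega) hns hv hdeg fun hns' => ?_
    have hX : (S.erase v).card = n := by rw [Finset.card_erase_of_mem hv, hn, Nat.add_sub_cancel]
    have := ih (hP.mono (Finset.filter_subset (fun g => v ∉ g) F))
      (fun g hg => h3 g (Finset.mem_filter.1 hg).1) (filter_notMem_subset_erase hS v) hns' hX
    rwa [hX, show n - 1 = S.card - 2 by omega] at this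

/-- A path-free family of triples on `n ≥ 8` points has at most as many members as the full star,
with equality only for the full star. -/
theorem PathFree.card_le_choose (hP : PathFree F) (h3 : ∀ g ∈ F, g.card = 3)
    (hS : ∀ g ∈ F, g ⊆ S) (h8 : 8 ≤ S.card) :
    F.card ≤ (S.card - 1).choose 2 ∧ (F.card = (S.card - 1).choose 2 →
      ∃ c, F = (S.powersetCard 3).filter (fun g => c ∈ g)) := by
  by_cases hs : ∃ c, ∀ g ∈ F, c ∈ g
  · obtain ⟨c, hc⟩ := hs
    refine ⟨card_le_of_point fun g hg => ⟨h3 g hg, hc g hg, hS g hg⟩, fun h => ⟨c, ?_⟩⟩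
    apply Finset.eq_of_subset_of_card_le
    · intro g hg
      exact Finset.mem_filter.2 ⟨Finset.mem_powersetCard.2 ⟨hS g hg, h3 g hg⟩, hc g hg⟩
    · rw [h]
      refine card_le_of_point (a := c) fun g hg => ?_
      rw [Finset.mem_filter, Finset.mem_powersetCard] at hg
      exact ⟨hg.1.2, hg.2, hg.1.1⟩
  · have := hP.card_lt_of_not_star h3 hS h8 hs
    exact ⟨this.le, fun h => absurd h this.ne⟩

end Bounds

/-! ### Transfer between 3-graphs and families of triples -/

lemma pathFree_edges_of_free {V : Type*} [DecidableEq V] {H : KGraph 3 V}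
    (hH : H.Free linearPath33) : PathFree H.edges := by
  intro e he f hf g hg hd hge hgf
  by_contra hsub
  obtain ⟨z, hzg, hz⟩ := Finset.not_subset.1 hsub
  obtain ⟨x, hxg, hxe⟩ := Finset.not_disjoint_iff.1 hge
  obtain ⟨y, hyg, hyf⟩ := Finset.not_disjoint_iff.1 hgf
  have hxf := Finset.disjoint_left.1 hd hxe
  have hye := Finset.disjoint_right.1 hd hyf
  rw [Finset.mem_union, not_or] at hz
  have hxz : x ≠ z := fun h => hz.1 (h ▸ hxe)
  have hyz : y ≠ z := fun h => hz.2 (h ▸ hyf)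
  have hxy : x ≠ y := fun h => hye (h ▸ hxe)
  have hgeq := eq_of_mem_of_card_eq_three (H.card_of_mem g hg) hxg hzg hyg hxz hxy hyz.symm
  obtain ⟨a, b, hxa, hxb, hab, rfl⟩ := exists_eq_of_mem (H.card_of_mem e he) hxe
  obtain ⟨c, d, hyc, hyd, hcd, rfl⟩ := exists_eq_of_mem (H.card_of_mem f hf) hyf
  subst hgeq
  simp only [Finset.disjoint_insert_left, Finset.disjoint_singleton_left, Finset.mem_insert,
    Finset.mem_singleton, not_or] at hd hz
  -- The bad edge is `g = {x, z, y}` with `x ∈ e`, `y ∈ f` and `z` outside both; it is the middle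
  -- edge of the path `a, b, x, z, y, c, d`.
  have hinj : Function.Injective ![a, b, x, z, y, c, d] := by
    rw [← List.nodup_ofFn]
    simp only [List.ofFn_succ, List.ofFn_zero, List.nodup_cons, List.mem_cons,
      List.not_mem_nil, or_false, not_or, List.nodup_nil, and_true]
    simp [Fin.succ]
    grind
  refine hH ⟨⟨_, hinj⟩, ?_⟩
  intro e' he'
  simp only [linearPath33, Finset.mem_insert, Finset.mem_singleton] at he'
  rcases he' with rfl | rfl | rfl
  · convert he using 1
    ext w
    simp
    tauto
  · convert hg using 1
    ext w
    simp
  · convert hf using 1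
    ext w
    simp

lemma free_of_pathFree_edges {V : Type*} [DecidableEq V] {H : KGraph 3 V}
    (hP : PathFree H.edges) : H.Free linearPath33 := by
  rintro ⟨φ, hφ⟩
  have h := hP _ (hφ {0, 1, 2} (by simp [linearPath33])) _ (hφ {4, 5, 6} (by simp [linearPath33]))
    _ (hφ {2, 3, 4} (by simp [linearPath33]))
    ((Finset.disjoint_map φ).2 (by decide))
    (by rw [Finset.disjoint_map]; decide) (by rw [Finset.disjoint_map]; decide)
  rw [← Finset.map_union, Finset.map_subset_map] at h
  exact absurd h (by decide)

lemma IsIsoTo.free {k : ℕ} {V W U : Type*} {H : KGraph k V} {G : KGraph k W} {F : KGraph k U}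
    (h : H.IsIsoTo G) (hG : G.Free F) : H.Free F := by
  obtain ⟨σ, hσ⟩ := h
  rintro ⟨φ, hφ⟩
  refine hG ⟨φ.trans σ.toEmbedding, fun e he => ?_⟩
  rw [← Finset.map_map]
  exact (hσ _).1 (hφ e he)

lemma IsIsoTo.size_eq {k : ℕ} {V W : Type*} {H : KGraph k V} {G : KGraph k W}
    (h : H.IsIsoTo G) : H.size = G.size := by
  obtain ⟨σ, hσ⟩ := h
  refine Finset.card_bij (fun e _ => e.map σ.toEmbedding) (fun e he => (hσ e).1 he)
    (fun e _ e' _ h => Finset.map_injective _ h) fun e he => ?_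
  refine ⟨e.map σ.symm.toEmbedding, ?_, ?_⟩
  · rw [hσ]
    simpa [Finset.map_map] using he
  · simp [Finset.map_map]

/-- The transport of a `k`-graph along a bijection of the vertices. -/
def transport {k : ℕ} {V W : Type*} (H : KGraph k V) (σ : V ≃ W) : KGraph k W where
  edges := H.edges.map (Finset.mapEmbedding σ.toEmbedding).toEmbedding
  card_of_mem := by
    intro e he
    obtain ⟨e', he', rfl⟩ := Finset.mem_map.1 he
    simpa using H.card_of_mem e' he'

lemma isIsoTo_transport {k : ℕ} {V W : Type*} (H : KGraph k V) (σ : V ≃ W) :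
    H.IsIsoTo (H.transport σ) := by
  refine ⟨σ, fun e => ?_⟩
  simp [transport]

lemma IsIsoTo.symm {k : ℕ} {V W : Type*} {H : KGraph k V} {G : KGraph k W}
    (h : H.IsIsoTo G) : G.IsIsoTo H := by
  obtain ⟨σ, hσ⟩ := h
  refine ⟨σ.symm, fun e => ?_⟩
  rw [hσ]
  simp [Finset.map_map]

/-- A `k`-graph `G` on `n` vertices determines the extremal problem if it is free and every free
`k`-graph on `n` vertices has at most as many edges, with equality only for copies of `G`. -/
lemma turanNumber_eq_and_uniqueExtremal {k n m : ℕ} {U W : Type*} {F : KGraph k W}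
    {G : KGraph k U} (σ : U ≃ Fin n) (hfree : G.Free F) (hsize : G.size = m)
    (hle : ∀ H : KGraph k (Fin n), H.Free F → H.size ≤ m)
    (heq : ∀ (V : Type u) [Fintype V], Fintype.card V = n → ∀ H : KGraph k V, H.Free F →
      H.size = m → H.IsIsoTo G) :
    turanNumber n F = m ∧ UniqueExtremal.{u} n F G := by
  -- `turanNumber` ranges over graphs on `Fin n`, so `G` is moved there along `σ`.
  have hmem : ∃ H : KGraph k (Fin n), H.Free F ∧ H.size = m :=
    ⟨G.transport σ, (G.isIsoTo_transport σ).symm.free hfree,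
      (G.isIsoTo_transport σ).size_eq ▸ hsize⟩
  have hex : turanNumber n F = m := by
    refine IsGreatest.csSup_eq ⟨hmem, ?_⟩
    rintro _ ⟨H, hH, rfl⟩
    exact hle H hH
  refine ⟨hex, fun V _ hV H => ?_⟩
  rw [IsExtremal, hV, hex]
  exact ⟨fun h => heq V hV H h.1 h.2, fun h => ⟨h.free hfree, h.size_eq.trans hsize⟩⟩

/-! ### The three ranges of `n` -/

lemma mem_complete {k n : ℕ} {e : Finset (Fin n)} : e ∈ (complete k n).edges ↔ e.card = k := by
  simp [complete, Finset.mem_powersetCard]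

lemma mem_fullStar {k n : ℕ} {v : Fin n} {e : Finset (Fin n)} :
    e ∈ (fullStar k v).edges ↔ e.card = k ∧ v ∈ e := by
  simp [fullStar, Finset.mem_powersetCard]

lemma size_complete (k n : ℕ) : (complete k n).size = n.choose k := by
  simp [size, complete]

lemma size_le_choose {n k : ℕ} {V : Type*} [Fintype V] (hV : Fintype.card V = n)
    (H : KGraph k V) : H.size ≤ n.choose k ∧
      (H.size = n.choose k → H.edges = Finset.univ.powersetCard k) := by
  have hsub : H.edges ⊆ Finset.univ.powersetCard k := fun e he =>
    Finset.mem_powersetCard.2 ⟨Finset.subset_univ e, H.card_of_mem e he⟩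
  have hcard : ((Finset.univ : Finset V).powersetCard k).card = n.choose k := by
    rw [Finset.card_powersetCard, Finset.card_univ, hV]
  refine ⟨hcard ▸ Finset.card_le_card hsub, fun h => ?_⟩
  exact Finset.eq_of_subset_of_card_le hsub (hcard.trans h.symm).le

/-- A `3`-graph whose edges lie in a set of six vertices contains no linear path. -/
lemma pathFree_of_card_le_six {V : Type*} [DecidableEq V] {F : Finset (Finset V)} {W : Finset V}
    (hW : W.card ≤ 6) (h3 : ∀ g ∈ F, g.card = 3) (hF : ∀ g ∈ F, g ⊆ W) : PathFree F := by
  intro e he f hf g hg hd _ _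
  have heq : e ∪ f = W := by
    refine Finset.eq_of_subset_of_card_le (Finset.union_subset (hF e he) (hF f hf)) ?_
    rw [Finset.card_union_of_disjoint hd, h3 e he, h3 f hf]
    exact hW
  exact heq ▸ hF g hg

lemma turan_linearPath33_of_le_six {n : ℕ} (hn : n ≤ 6) : turanNumber n linearPath33 = n.choose 3 ∧
    UniqueExtremal.{u} n linearPath33 (complete 3 n) := by
  refine turanNumber_eq_and_uniqueExtremal (Equiv.refl _) ?_ (size_complete 3 n)
    (fun H _ => (size_le_choose (Fintype.card_fin n) H).1) ?_
  · exact free_of_pathFree_edges (pathFree_of_card_le_six (W := Finset.univ) (by simpa using hn)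
      (complete 3 n).card_of_mem (fun g _ => Finset.subset_univ g))
  · intro V _ hV H _ hsize
    refine ⟨Fintype.equivFinOfCardEq hV, fun e => ?_⟩
    rw [mem_complete, (size_le_choose hV H).2 hsize]
    simp [Finset.mem_powersetCard]

lemma complete_one_edges : (complete 3 1).edges = ∅ := rfl

lemma mem_disjointUnion_complete {e : Finset (Fin 6 ⊕ Fin 1)} :
    e ∈ ((complete 3 6).disjointUnion (complete 3 1)).edges ↔
      e.card = 3 ∧ Sum.inr 0 ∉ e := by
  simp only [disjointUnion, complete_one_edges, Finset.image_empty, Finset.union_empty,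
    Finset.mem_image]
  constructor
  · rintro ⟨a, ha, rfl⟩
    rw [mem_complete] at ha
    simp [ha]
  · rintro ⟨h3, h⟩
    have he : (e.preimage Sum.inl Sum.inl_injective.injOn).map Function.Embedding.inl = e := by
      ext x
      rcases x with x | x
      · simp
      · rw [Subsingleton.elim x 0]
        simp [h]
    refine ⟨_, ?_, he⟩
    rw [mem_complete, ← Finset.card_map Function.Embedding.inl, he, h3]

lemma turan_linearPath33_seven : turanNumber 7 linearPath33 = 20 ∧
    UniqueExtremal.{u} 7 linearPath33 ((complete 3 6).disjointUnion (complete 3 1)) := by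
  refine turanNumber_eq_and_uniqueExtremal finSumFinEquiv ?_ ?_ ?_ ?_
  · refine free_of_pathFree_edges (pathFree_of_card_le_six (W := {Sum.inr 0}ᶜ) ?_
      (KGraph.card_of_mem _) fun g hg => ?_)
    · rw [Finset.card_compl]
      simp
    · exact Finset.subset_compl_comm.1
        (by simpa using (mem_disjointUnion_complete.1 hg).2)
  · have hedges : ((complete 3 6).disjointUnion (complete 3 1)).edges =
        (complete 3 6).edges.image (fun e => e.map Function.Embedding.inl) := by
      simp [disjointUnion, complete_one_edges]
    rw [size, hedges, Finset.card_image_of_injective _ (Finset.map_injective _)]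
    exact size_complete 3 6
  · intro H hH
    exact ((pathFree_edges_of_free hH).card_le_of_seven H.card_of_mem
      (fun g _ => Finset.subset_univ g) (by simp)).1
  · intro V _ hV H hH hsize
    classical
    obtain ⟨W, hW, hF⟩ := ((pathFree_edges_of_free hH).card_le_of_seven H.card_of_mem
      (fun g _ => Finset.subset_univ g) (by simpa using hV)).2 hsize
    have hc1 : Fintype.card {x // x ∈ W} = 6 := by simpa using hW
    have hc2 : Fintype.card {x // x ∉ W} = 1 := by
      have := Fintype.card_subtype_compl (fun x => x ∈ W)
      rw [this, hV, hc1]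
    -- The six points of `W` go to the clique, the remaining point to the isolated vertex.
    let σ : V ≃ Fin 6 ⊕ Fin 1 := (Equiv.sumCompl (fun x => x ∈ W)).symm.trans
      (Equiv.sumCongr (Fintype.equivFinOfCardEq hc1) (Fintype.equivFinOfCardEq hc2))
    have hσ : ∀ x, σ x = Sum.inr 0 ↔ x ∉ W := by
      intro x
      by_cases hx : x ∈ W
      · simp [σ, hx, Equiv.sumCompl_symm_apply_of_pos]
      · simp [σ, hx, Equiv.sumCompl_symm_apply_of_neg, Subsingleton.elim _ (0 : Fin 1)]
    refine ⟨σ, fun e => ?_⟩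
    rw [mem_disjointUnion_complete, hF, Finset.mem_powersetCard, Finset.card_map, and_comm]
    refine and_congr_right fun _ => ?_
    simp only [Finset.mem_map_equiv]
    constructor
    · intro h hmem
      exact (hσ _).1 (σ.apply_symm_apply _) (h hmem)
    · intro h x hx
      by_contra hxW
      rw [← (hσ x).2 hxW, σ.symm_apply_apply] at h
      exact h hx

lemma turan_linearPath33_of_eight_le {n : ℕ} (hn : 8 ≤ n) (v : Fin n) :
    turanNumber n linearPath33 = (n - 1).choose 2 ∧
    UniqueExtremal.{u} n linearPath33 (fullStar 3 v) := by
  refine turanNumber_eq_and_uniqueExtremal (Equiv.refl _) ?_ ?_ ?_ ?_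
  · refine free_of_pathFree_edges (Intersecting.pathFree fun e he f hf => ?_)
    exact Finset.not_disjoint_iff.2 ⟨v, (mem_fullStar.1 he).2, (mem_fullStar.1 hf).2⟩
  · have hc : (fullStar 3 v).edges =
        ((Finset.univ.erase v).powersetCard 2).image (insert v) := by
      ext e
      rw [mem_fullStar, Finset.mem_image]
      constructor
      · rintro ⟨h3, hv⟩
        refine ⟨e.erase v, Finset.mem_powersetCard.2
          ⟨Finset.erase_subset_erase v (Finset.subset_univ e), ?_⟩, Finset.insert_erase hv⟩
        rw [Finset.card_erase_of_mem hv, h3]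
      · rintro ⟨a, ha, rfl⟩
        rw [Finset.mem_powersetCard, Finset.subset_erase] at ha
        exact ⟨by rw [Finset.card_insert_of_notMem ha.1.2, ha.2], Finset.mem_insert_self v a⟩
    rw [size, hc, Finset.card_image_of_injOn, Finset.card_powersetCard,
      Finset.card_erase_of_mem (Finset.mem_univ v), Finset.card_univ, Fintype.card_fin]
    intro a ha b hb hab
    rw [Finset.mem_coe, Finset.mem_powersetCard, Finset.subset_erase] at ha hb
    have hab : insert v a = insert v b := hab
    rw [← Finset.erase_insert ha.1.2, hab, Finset.erase_insert hb.1.2]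
  · intro H hH
    have := ((pathFree_edges_of_free hH).card_le_choose H.card_of_mem
      (fun g _ => Finset.subset_univ g) (by simpa using hn)).1
    simpa [size] using this
  · intro V _ hV H hH hsize
    classical
    obtain ⟨c, hc⟩ := ((pathFree_edges_of_free hH).card_le_choose H.card_of_mem
      (fun g _ => Finset.subset_univ g) (by simpa [hV] using hn)).2
      (by rw [Finset.card_univ, hV]; exact hsize)
    let τ : V ≃ Fin n := Fintype.equivFinOfCardEq hV
    -- The transposition corrects an arbitrary bijection so that the centre `c` goes to `v`.
    let σ : V ≃ Fin n := τ.trans (Equiv.swap (τ c) v)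
    have hσ : σ.symm v = c := by simp [σ]
    refine ⟨σ, fun e => ?_⟩
    rw [mem_fullStar, hc, Finset.mem_filter, Finset.mem_powersetCard, Finset.card_map,
      Finset.mem_map_equiv, hσ]
    simp

end KGraph

theorem theorem1 (n : ℕ) :
    (n ≤ 6 →
      KGraph.turanNumber n KGraph.linearPath33 = n.choose 3 ∧
      KGraph.UniqueExtremal.{u} n KGraph.linearPath33 (KGraph.complete 3 n)) ∧
    (n = 7 →
      KGraph.turanNumber n KGraph.linearPath33 = 20 ∧
      KGraph.UniqueExtremal.{u} n KGraph.linearPath33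
        ((KGraph.complete 3 6).disjointUnion (KGraph.complete 3 1))) ∧
    (∀ hn : 8 ≤ n,
      KGraph.turanNumber n KGraph.linearPath33 = (n - 1).choose 2 ∧
      KGraph.UniqueExtremal.{u} n KGraph.linearPath33
        (KGraph.fullStar 3 (⟨0, by omega⟩ : Fin n))) := by
  refine ⟨KGraph.turan_linearPath33_of_le_six, ?_, fun hn => KGraph.turan_linearPath33_of_eight_le hn _⟩
  rintro rfl
  exact KGraph.turan_linearPath33_seven
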